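/- Let $k\ge 5$ be an integer and let $p\ge 3\lceil k/2\rceil-2$ be a prime. Let $G=\langle x,y\rangle$ be a finite group with $x^p=y^2=1$ and $yxy\notin\langle x\rangle$, and suppose that $G$ has no proper subgroup of index less than $4$. Let $R=\{x^{\pm1},x^{\pm2},\dots,x^{\pm\lfloor (k-1)/2\rfloor}\}$, and let $S=R\cup\{y\}$ if $k$ is odd and $S=R\cup\{y,x^{-1}yx\}$ if $k$ is even. Let $\Gamma=\mathrm{Cay}(G,S)$ be the Cayley graph with vertex set $G$ in which $u,v$ are adjacent if and only if $vu^{-1}\in S$, and let $\mathrm{Aut}(G,S)=\{\alpha\in\mathrm{Aut}(G)\mid S^\alpha=S\}$. Then $\Gamma$ is a graphical regular representation (GRR) of $G$, that is, the full automorphism group $\mathrm{Aut}(\Gamma)$ acts regularly on the vertex set of $\Gamma$ and is isomorphic to $G$, if and only if $\mathrm{Aut}(G,S)=1$. -/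

import Mathlib

/-- The Cayley graph `Cay(G, S)`: the simple graph with vertex set `G` in which `u` and `v` are
adjacent iff `v * u⁻¹ ∈ S`. The set `S` is meant to be inverse-closed and not to contain `1`; the
definition symmetrises and removes loops so as to be a simple graph for every `S`. -/
def cayleyGraph {G : Type*} [Group G] (S : Set G) : SimpleGraph G where
  Adj u v := u ≠ v ∧ (v * u⁻¹ ∈ S ∨ u * v⁻¹ ∈ S)
  symm := ⟨fun _ _ h => ⟨h.1.symm, h.2.symm⟩⟩
  loopless := ⟨fun _ h => h.1 rfl⟩

/-- For an inverse-closed `S ⊆ G \ {1}`, adjacency in `Cay(G, S)` is exactly `v * u⁻¹ ∈ S`. -/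
theorem cayleyGraph_adj_iff {G : Type*} [Group G] {S : Set G} (h1 : (1 : G) ∉ S)
    (hinv : ∀ s ∈ S, s⁻¹ ∈ S) (u v : G) :
    (cayleyGraph S).Adj u v ↔ v * u⁻¹ ∈ S := by
  constructor
  · rintro ⟨_, h | h⟩
    · exact h
    · simpa using hinv _ h
  · intro h
    refine ⟨?_, Or.inl h⟩
    rintro rfl
    exact h1 (by simpa using h)

/-- `Γ` is a graphical regular representation of `G`: the full automorphism group of `Γ` acts
regularly on the (nonempty) vertex set of `Γ`, and is isomorphic to `G`. -/
def IsGRR {V : Type*} (Γ : SimpleGraph V) (G : Type*) [Group G] : Prop :=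
  Nonempty V ∧ (∀ u v : V, ∃! φ : Γ ≃g Γ, φ u = v) ∧ Nonempty (G ≃* (Γ ≃g Γ))

/-- `Aut(G, S) = {α ∈ Aut(G) ∣ S^α = S}`, the setwise stabiliser of `S` in `Aut(G)`. -/
def autStabilizer (G : Type*) [Group G] (S : Set G) : Subgroup (MulAut G) where
  carrier := {α | α '' S = S}
  one_mem' := by simp
  mul_mem' := by
    intro α β hα hβ
    simp only [Set.mem_setOf_eq] at *
    rw [MulAut.coe_mul, Set.image_comp, hβ, hα]
  inv_mem' := by
    intro α hα
    simp only [Set.mem_setOf_eq] at *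
    conv_lhs => rw [← hα]
    rw [← Set.image_comp, ← MulAut.coe_mul, inv_mul_cancel]
    simp

/-- `R = {x^{±1}, x^{±2}, …, x^{±⌊(k-1)/2⌋}}` (used for `k ≥ 5`). -/
def powersR {G : Type*} [Group G] (k : ℕ) (x : G) : Set G :=
  {g | ∃ j : ℕ, 1 ≤ j ∧ j ≤ (k - 1) / 2 ∧ (g = x ^ j ∨ g = (x ^ j)⁻¹)}

/-- `S = R ∪ {y}` if `k` is odd and `S = R ∪ {y, x⁻¹yx}` if `k` is even. -/
def connectionSet {G : Type*} [Group G] (k : ℕ) (x y : G) : Set G :=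
  if Odd k then powersR k x ∪ {y} else powersR k x ∪ {y, x⁻¹ * y * x}

/-- `S` is inverse-closed as soon as `y² = 1`. -/
theorem inv_mem_connectionSet {G : Type*} [Group G] {k : ℕ} {x y : G} (hy : y ^ 2 = 1) :
    ∀ s ∈ connectionSet k x y, s⁻¹ ∈ connectionSet k x y := by
  have hyi : y⁻¹ = y := inv_eq_of_mul_eq_one_left (by rw [← sq, hy])
  have hR : ∀ s ∈ powersR k x, s⁻¹ ∈ powersR k x := by
    rintro s ⟨j, h1, h2, rfl | rfl⟩
    · exact ⟨j, h1, h2, Or.inr rfl⟩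
    · exact ⟨j, h1, h2, Or.inl (inv_inv _)⟩
  intro s hs
  unfold connectionSet at *
  split_ifs at * with hk
  · rcases hs with hs | rfl
    · exact Or.inl (hR s hs)
    · exact Or.inr hyi
  · rcases hs with hs | rfl | rfl
    · exact Or.inl (hR s hs)
    · exact Or.inr (Or.inl hyi)
    · exact Or.inr (Or.inr (by simp [hyi, mul_assoc]))

/-- `1 ∉ S` as soon as
`x ^ p = 1`, `y ^ 2 = 1` and `yxy ∉ ⟨x⟩` with `p` prime and `1 ≤ k ≤ 2 * p`. -/
theorem one_notMem_connectionSet {G : Type*} [Group G] {k p : ℕ} {x y : G} (hk : 1 ≤ k)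
    (hp : p.Prime) (hkp : k ≤ 2 * p) (hx : x ^ p = 1)
    (hxy : y * x * y ∉ Subgroup.zpowers x) (hy : y ^ 2 = 1) :
    (1 : G) ∉ connectionSet k x y := by
  have hy1 : y ≠ 1 := by
    rintro rfl
    exact hxy (by simp)
  have hx1 : x ≠ 1 := by
    rintro rfl
    exact hxy (by simp [← sq, hy])
  have hord : orderOf x = p := by
    haveI := Fact.mk hp
    exact orderOf_eq_prime hx hx1
  have hR : (1 : G) ∉ powersR k x := by
    rintro ⟨j, h1, h2, h | h⟩
    · have := Nat.le_of_dvd h1 (hord ▸ orderOf_dvd_of_pow_eq_one h.symm)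
      omega
    · have h' : x ^ j = 1 := by simpa using h.symm
      have := Nat.le_of_dvd h1 (hord ▸ orderOf_dvd_of_pow_eq_one h')
      omega
  unfold connectionSet
  split_ifs
  · rintro (h | h)
    · exact hR h
    · exact hy1 (Eq.symm h)
  · rintro (h | h | h)
    · exact hR h
    · exact hy1 (Eq.symm h)
    · apply hy1
      have h2 : x⁻¹ * y * x = 1 := Eq.symm h
      calc y = x * (x⁻¹ * y * x) * x⁻¹ := by group
        _ = 1 := by rw [h2]; simp

/-! An element of `Aut(G, S)` is a graph automorphism fixing `1`, so a GRR forces `Aut(G, S) = 1`.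
Conversely it is enough that every automorphism `φ` of `Γ` fixing `1` is multiplicative.

Put `d = (k - 1) / 2`. Counting triangles separates the edges: an edge labelled `x^{±1}` lies in at
least `2d - 2`, one labelled `x^j` with `|j| ≥ 2` in at most `2d - 3`, one labelled by an involution
in none. So `φ` preserves `x`-edges (`map_generator_mul`) and acts on each cycle `⟨x⟩u` as a
dihedral symmetry (`map_zpow_mul`).

For even `k`, 4-cycles through the two involutions carry the sense of traversal from a coset to the
adjacent ones, so one sign governs all of `φ` and `φ` is multiplicative (`map_mul_of_even`).

For odd `k`, `φ (y * u) = y * φ u`, and the stabiliser `P` of `1` is a 2-group. The pointwise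
stabiliser `K` of `⟨x⟩` has index at most 2 in `P`; translation by `x` normalises `K`, translation
by `y` normalises `P`, and no nontrivial subgroup of `P` is normalised by both. A pushing-up
argument with Thompson's maximal abelian subgroups gives `|P| ≤ 4` (`card_le_four`). Then the
translations have index at most 4 in `Aut Γ`; the index hypothesis makes them normal, and `P` acts
by group automorphisms (`map_mul_of_card_le_four`). -/

/-! ### Pushing up: an element of order `p` acting on a 2-group. -/

theorem commute_of_commute_pow {A : Type*} [Group A] {p m : ℕ} (hp : p.Prime) {r a : A}
    (hr : r ^ p = 1) (hm : ¬ p ∣ m) (h : Commute (r ^ m) a) : Commute r a := by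
  have hc : m.Coprime (orderOf r) :=
    Nat.Coprime.coprime_dvd_right (orderOf_dvd_of_pow_eq_one hr)
      ((Nat.Prime.coprime_iff_not_dvd hp).2 hm).symm
  obtain ⟨n, hn⟩ := exists_pow_eq_self_of_coprime hc
  rw [← hn]
  exact h.pow_left n

theorem eq_one_of_pow_prime_of_two_pow {A : Type*} [Group A] {p n : ℕ} (hp : p.Prime)
    (h2 : p ≠ 2) {a : A} (ha : a ^ p = 1) (ha2 : a ^ 2 ^ n = 1) : a = 1 := by
  have h := Nat.dvd_gcd (orderOf_dvd_of_pow_eq_one ha) (orderOf_dvd_of_pow_eq_one ha2)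
  have hc : Nat.Coprime p (2 ^ n) := ((Nat.coprime_primes hp Nat.prime_two).2 h2).pow_right n
  rw [hc.gcd_eq_one, Nat.dvd_one] at h
  exact orderOf_eq_one_iff.1 h

/-- An element of prime order `p > m` acting by conjugation on a `2`-subgroup, and centralising a
subgroup of index at most `4`, centralises the whole subgroup. -/
theorem commute_of_relIndex_le_four {A : Type*} [Group A] [Finite A] {p : ℕ} (hp : p.Prime)
    (h5 : 5 ≤ p) {r : A} (hr : r ^ p = 1) (Z F : Subgroup A)
    (hZ : ∀ a ∈ Z, r * a * r⁻¹ ∈ Z) (h2 : ∀ a ∈ Z, ∃ n, a ^ 2 ^ n = 1)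
    (hF : ∀ a ∈ F, Commute r a) (hidx : F.relIndex Z ≤ 4) :
    ∀ a ∈ Z, Commute r a := by
  intro z hz
  have hZn : ∀ n : ℕ, r ^ n * z * (r ^ n)⁻¹ ∈ Z := by
    intro n
    induction n with
    | zero => simpa using hz
    | succ n ih =>
      have := hZ _ ih
      rw [pow_succ']
      simpa [mul_assoc] using this
  have hcard : Nat.card (Z ⧸ F.subgroupOf Z) < Nat.card (Fin 5) := by
    rw [Nat.card_fin]
    exact Nat.lt_succ_of_le hidx
  -- Five conjugates of `z` lie in at most four cosets of `F`, so two share a coset; their exponents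
  -- differ by `m < 5 ≤ p`.
  obtain ⟨i, j, hij, he⟩ : ∃ i j : Fin 5, i < j ∧
      (QuotientGroup.mk (⟨_, hZn i⟩ : Z) : Z ⧸ F.subgroupOf Z) =
        QuotientGroup.mk (⟨_, hZn j⟩ : Z) := by
    have : ¬ Function.Injective (fun i : Fin 5 =>
        (QuotientGroup.mk (⟨_, hZn i⟩ : Z) : Z ⧸ F.subgroupOf Z)) := fun hinj =>
      absurd (Nat.card_le_card_of_injective _ hinj) (not_le.2 hcard)
    simp only [Function.Injective, not_forall] at this
    obtain ⟨i, j, he, hne⟩ := this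
    rcases lt_or_gt_of_ne hne with h | h
    · exact ⟨i, j, h, he⟩
    · exact ⟨j, i, h, he.symm⟩
  rw [QuotientGroup.eq, Subgroup.mem_subgroupOf] at he
  obtain ⟨m, hm⟩ : ∃ m : ℕ, (j : ℕ) = i + m := ⟨j - i, by have : (i : ℕ) < j := hij; omega⟩
  have hm0 : 0 < m ∧ m < 5 := by have : (i : ℕ) < j := hij; have := j.2; omega
  set f : A := z⁻¹ * (r ^ m * z * (r ^ m)⁻¹) with hf
  -- Equality of the cosets puts `r ^ i * f * (r ^ i)⁻¹` in `F`; since `r` centralises that element,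
  -- it equals `f`.
  have hcf : Commute r f := by
    have h1 : r ^ (i : ℕ) * f * (r ^ (i : ℕ))⁻¹ ∈ F := by
      convert he using 1
      simp only [Subgroup.coe_mul, InvMemClass.coe_inv, hm, pow_add, hf]
      group
    have h2 := ((hF _ h1).pow_left i).symm.eq
    have h3 : r ^ (i : ℕ) * f * (r ^ (i : ℕ))⁻¹ = f := by
      have : r ^ (i : ℕ) * f = r ^ (i : ℕ) * (r ^ (i : ℕ) * f * (r ^ (i : ℕ))⁻¹) := by
        rw [← h2]; group
      exact (mul_left_cancel this).symm
    rw [h3] at h1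
    exact hF _ h1
  have hfZ : f ∈ Z := Z.mul_mem (Z.inv_mem hz) (hZn m)
  have hstep : ∀ n : ℕ, (r ^ m) ^ n * z * ((r ^ m) ^ n)⁻¹ = z * f ^ n := by
    intro n
    induction n with
    | zero => simp
    | succ n ih =>
      have hc : r ^ m * f ^ n * (r ^ m)⁻¹ = f ^ n := by
        rw [((hcf.pow_left m).pow_right n).eq]; group
      calc (r ^ m) ^ (n + 1) * z * ((r ^ m) ^ (n + 1))⁻¹
          = r ^ m * ((r ^ m) ^ n * z * ((r ^ m) ^ n)⁻¹) * (r ^ m)⁻¹ := by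
            rw [pow_succ' (r ^ m)]; group
        _ = (r ^ m * z * (r ^ m)⁻¹) * (r ^ m * f ^ n * (r ^ m)⁻¹) := by rw [ih]; group
        _ = z * f ^ (n + 1) := by
            rw [hc, pow_succ', ← mul_assoc]
            congr 1
            rw [hf]; group
  -- Conjugating `p` times by `r ^ m` is trivial, yet multiplies `z` by `f ^ p`. As `f` is also a
  -- 2-element, it vanishes.
  have hfp : f ^ p = 1 := by
    have h := hstep p
    rw [← pow_mul, mul_comm m p, pow_mul, hr] at h
    simpa using h
  obtain ⟨n, hn⟩ := h2 f hfZ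
  have hf1 : f = 1 := eq_one_of_pow_prime_of_two_pow hp (by omega) hfp hn
  refine commute_of_commute_pow hp hr (m := m) (fun hd => ?_) ?_
  · have := Nat.le_of_dvd hm0.1 hd
    omega
  · have h : r ^ m * z * (r ^ m)⁻¹ = z := by
      rw [hf, inv_mul_eq_one] at hf1
      exact hf1.symm
    exact mul_inv_eq_iff_eq_mul.1 h

theorem relIndex_le_two {A : Type*} [Group A] {P K : Subgroup A}
    (h : ∀ a ∈ P, ∀ b ∈ P, a ∉ K → b ∉ K → a * b⁻¹ ∈ K) : K.relIndex P ≤ 2 := by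
  by_cases hPK : P ≤ K
  · rw [Subgroup.relIndex_eq_one.2 hPK]; norm_num
  obtain ⟨a, ha, haK⟩ := SetLike.not_le_iff_exists.1 hPK
  refine le_of_eq (Subgroup.index_eq_two_iff.2 ⟨⟨a, ha⟩, ?_⟩)
  rintro ⟨b, hb⟩
  simp only [Subgroup.mem_subgroupOf, Subgroup.coe_mul]
  by_cases hbK : b ∈ K
  · refine Or.inr ⟨hbK, fun h' => haK ?_⟩
    simpa using K.mul_mem (K.inv_mem hbK) h'
  · refine Or.inl ⟨?_, hbK⟩
    simpa using h b hb a⁻¹ (P.inv_mem ha) hbK (by simpa using haK)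

/-- If some `z` centralises the `2`-group `K` and inverts `r` modulo `K`, then `r` centralises `K`. -/
theorem commute_of_center_not_le {A : Type*} [Group A] {p : ℕ} (hp : p.Prime)
    (h5 : 5 ≤ p) {K : Subgroup A} {r z : A} (hr : r ^ p = 1)
    (hrK : ∀ a ∈ K, r * a * r⁻¹ ∈ K) (h2 : ∀ a ∈ K, ∃ n, a ^ 2 ^ n = 1)
    (hz : ∀ a ∈ K, Commute z a) (hzr : r * (z * r * z⁻¹) ∈ K) :
    ∀ a ∈ K, Commute r a := by
  intro a ha
  have hrKn : ∀ n : ℕ, ∀ a ∈ K, r ^ n * a * (r ^ n)⁻¹ ∈ K := by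
    intro n
    induction n with
    | zero => simp
    | succ n ih =>
      intro a ha
      have := hrK _ (ih a ha)
      rw [pow_succ']
      simpa [mul_assoc] using this
  have hinv : r⁻¹ = r ^ (p - 1) := by
    rw [inv_eq_iff_mul_eq_one, ← pow_succ', Nat.sub_add_cancel hp.one_le, hr]
  have hrK' : ∀ a ∈ K, r⁻¹ * a * r ∈ K := by
    intro a ha
    have := hrKn (p - 1) a ha
    rwa [← hinv, inv_inv] at this
  set w := r * z * r⁻¹ with hw
  have hwc : ∀ a ∈ K, w * a * w⁻¹ = a := by
    intro a ha
    have h := (hz _ (hrK' a ha)).eq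
    calc w * a * w⁻¹ = r * (z * (r⁻¹ * a * r)) * z⁻¹ * r⁻¹ := by rw [hw]; group
      _ = a := by rw [h]; group
  have hwc' : ∀ a ∈ K, w⁻¹ * a * w = a := by
    intro a ha
    conv_lhs => rw [← hwc a ha]
    group
  have hzc : ∀ a ∈ K, z * a * z⁻¹ = a := fun a ha => by rw [(hz a ha).eq]; group
  set k := r * (z * r * z⁻¹) with hk
  -- Since `r ^ 2 = w⁻¹ * k * z` with `w` and `z` centralising `K`, `r ^ 2` acts on `K` as the
  -- 2-element `k`. Hence a 2-power of `r` centralises `K`, and so does `r`.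
  have hr2 : ∀ a ∈ K, r ^ 2 * a * (r ^ 2)⁻¹ = k * a * k⁻¹ := by
    intro a ha
    have e : r ^ 2 = w⁻¹ * k * z := by rw [hw, hk, sq]; group
    calc r ^ 2 * a * (r ^ 2)⁻¹ = w⁻¹ * (k * (z * a * z⁻¹) * k⁻¹) * w := by rw [e]; group
      _ = k * a * k⁻¹ := by
        rw [hzc a ha, hwc' _ (K.mul_mem (K.mul_mem hzr ha) (K.inv_mem hzr))]
  have hr2n : ∀ n : ℕ, (r ^ 2) ^ n * a * ((r ^ 2) ^ n)⁻¹ = k ^ n * a * (k ^ n)⁻¹ := by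
    intro n
    induction n with
    | zero => simp
    | succ n ih =>
      calc (r ^ 2) ^ (n + 1) * a * ((r ^ 2) ^ (n + 1))⁻¹
          = r ^ 2 * ((r ^ 2) ^ n * a * ((r ^ 2) ^ n)⁻¹) * (r ^ 2)⁻¹ := by
            rw [pow_succ' (r ^ 2)]; group
        _ = k * (k ^ n * a * (k ^ n)⁻¹) * k⁻¹ := by
            rw [ih, hr2 _ (K.mul_mem (K.mul_mem (K.pow_mem hzr n) ha)
              (K.inv_mem (K.pow_mem hzr n)))]
        _ = _ := by rw [pow_succ' k]; group
  obtain ⟨n, hn⟩ := h2 k hzr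
  have h := hr2n (2 ^ n)
  rw [hn, ← pow_mul, ← pow_succ'] at h
  refine commute_of_commute_pow hp hr (m := 2 ^ (n + 1)) (fun hd => ?_) ?_
  · have := Nat.le_of_dvd (by norm_num) (hp.dvd_of_dvd_pow hd)
    omega
  · have h' : r ^ 2 ^ (n + 1) * a * (r ^ 2 ^ (n + 1))⁻¹ = a := by simpa using h
    exact mul_inv_eq_iff_eq_mul.1 h'

/-- An abelian subgroup `E` of maximal order in the `2`-group `P`, not contained in `K`, forces `r`
to centralise the centre of `K`. -/
theorem commute_of_maximal_abelian_not_le {A : Type*} [Group A] [Finite A] {p : ℕ} (hp : p.Prime)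
    (h5 : 5 ≤ p) {P K E : Subgroup A} {r e : A} (hKP : K ≤ P) (hEP : E ≤ P) (hr : r ^ p = 1)
    (hrK : ∀ a ∈ K, r * a * r⁻¹ ∈ K) (h2 : ∀ a ∈ K, ∃ n, a ^ 2 ^ n = 1)
    (hidx : K.relIndex P ≤ 2) (hE : ∀ a ∈ E, ∀ b ∈ E, a * b = b * a)
    (hmax : ∀ F ≤ P, (∀ a ∈ F, ∀ b ∈ F, a * b = b * a) → Nat.card F ≤ Nat.card E)
    (he : e ∈ E) (her : r * (e * r * e⁻¹) ∈ K) {z : A} (hz : z ∈ K)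
    (hzK : ∀ a ∈ K, Commute z a) : Commute r z := by
  set Z : Subgroup A := K ⊓ Subgroup.centralizer K with hZ
  have memZ : ∀ {a}, a ∈ Z ↔ a ∈ K ∧ ∀ b ∈ K, a * b = b * a := by
    intro a
    rw [hZ, Subgroup.mem_inf, Subgroup.mem_centralizer_iff]
    exact and_congr_right fun _ => ⟨fun h b hb => (h b hb).symm, fun h b hb => (h b hb).symm⟩
  have hrK' : ∀ a ∈ K, r⁻¹ * a * r ∈ K := by
    have : r ∈ Subgroup.normalizer (K : Set A) := Subgroup.mem_normalizer_fintype hrK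
    intro a ha
    exact (Subgroup.mem_normalizer_iff''.1 this a).1 ha
  have hrZ : ∀ a ∈ Z, r * a * r⁻¹ ∈ Z := by
    intro a ha
    rw [memZ] at ha ⊢
    refine ⟨hrK _ ha.1, fun b hb => ?_⟩
    have h := ha.2 _ (hrK' b hb)
    calc r * a * r⁻¹ * b = r * (a * (r⁻¹ * b * r)) * r⁻¹ := by group
      _ = b * (r * a * r⁻¹) := by rw [h]; group
  have h2Z : ∀ a ∈ Z, ∃ n, a ^ 2 ^ n = 1 := fun a ha => h2 a (memZ.1 ha).1
  set D : Subgroup A := E ⊓ K with hD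
  -- `D * Z` is abelian, so `D ∩ Z` has index at most `2` in `Z`
  have hDZ : D.relIndex Z ≤ 2 := by
    set F : Subgroup A := Subgroup.closure ((D : Set A) ∪ Z) with hF
    have hFc : ∀ a ∈ F, ∀ b ∈ F, a * b = b * a := by
      have hcomm : IsMulCommutative F := Subgroup.isMulCommutative_closure (by
        rintro a (ha | ha) b (hb | hb)
        · exact hE a ha.1 b hb.1
        · exact ((memZ.1 hb).2 a ha.2).symm
        · exact (memZ.1 ha).2 b hb.2
        · exact (memZ.1 ha).2 b (memZ.1 hb).1)
      intro a ha b hb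
      have := hcomm.is_comm.comm (⟨a, ha⟩ : F) ⟨b, hb⟩
      exact congrArg Subtype.val this
    have hFP : F ≤ P := by
      rw [hF, Subgroup.closure_le]
      rintro a (ha | ha)
      · exact hEP ha.1
      · exact hKP (memZ.1 ha).1
    have hDF : D ≤ F := fun a ha => Subgroup.subset_closure (Or.inl ha)
    have hZF : Z ≤ F := fun a ha => Subgroup.subset_closure (Or.inr ha)
    have c1 : Nat.card D * D.relIndex F = Nat.card F := by
      have := Subgroup.relIndex_mul_relIndex ⊥ D F bot_le hDF
      rwa [Subgroup.relIndex_bot_left, Subgroup.relIndex_bot_left] at this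
    have c2 : Nat.card D * D.relIndex E = Nat.card E := by
      have := Subgroup.relIndex_mul_relIndex ⊥ D E bot_le inf_le_left
      rwa [Subgroup.relIndex_bot_left, Subgroup.relIndex_bot_left] at this
    have c3 : D.relIndex E ≤ 2 := by
      rw [hD, Subgroup.inf_relIndex_left]
      exact (Subgroup.relIndex_le_of_le_right hEP
        Subgroup.FiniteIndex.index_ne_zero).trans hidx
    have c4 : D.relIndex Z ≤ D.relIndex F :=
      Subgroup.relIndex_le_of_le_right hZF Subgroup.FiniteIndex.index_ne_zero
    have c5 := hmax F hFP hFc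
    have c6 : 0 < Nat.card D := Nat.card_pos
    rw [← c1, ← c2] at c5
    exact c4.trans ((Nat.le_of_mul_le_mul_left c5 c6).trans c3)
  -- Conjugation by `r` preserves the centre `Z` of `K`, so the conjugate of `D` also meets `Z` in
  -- index at most 2, and `D ⊓ D' ⊓ Z` has index at most 4 in `Z`.
  set D' : Subgroup A := D.map (MulAut.conj r).toMonoidHom with hD'
  have hZmap : Z.map (MulAut.conj r).toMonoidHom = Z := by
    refine Subgroup.eq_of_le_of_card_ge ?_ ?_
    · rintro _ ⟨a, ha, rfl⟩
      exact hrZ a ha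
    · exact (Subgroup.card_map_of_injective (MulAut.conj r).injective).ge
  have hDZ' : D'.relIndex Z ≤ 2 := by
    rw [← hZmap, hD', Subgroup.relIndex_map_map_of_injective _ _ (MulAut.conj r).injective]
    exact hDZ
  refine commute_of_relIndex_le_four hp h5 hr Z ((D ⊓ D') ⊓ Z) hrZ h2Z ?_ ?_ z
    (memZ.2 ⟨hz, hzK⟩)
  · rintro a ⟨⟨ha, b, hb, hba⟩, haZ⟩
    have hba : r * b * r⁻¹ = a := hba
    have h1 : e * a * e⁻¹ = a := by rw [hE e he a ha.1]; group
    have h2 : (r * e * r⁻¹)⁻¹ * a * (r * e * r⁻¹) = a := by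
      have hc : e⁻¹ * b * e = b := by rw [mul_assoc, hE b hb.1 e he]; group
      calc (r * e * r⁻¹)⁻¹ * a * (r * e * r⁻¹) = r * (e⁻¹ * b * e) * r⁻¹ := by rw [← hba]; group
        _ = a := by rw [hc, hba]
    have h3 : ∀ b ∈ K, b * a * b⁻¹ = a := fun b hb => by
      rw [← (memZ.1 haZ).2 b hb]; group
    -- Here `r ^ 2` is a product of `e`, its `r`-conjugate and an element of `K`, each of which
    -- centralises `a`: the first because `a ∈ D`, the second because `a ∈ D'`, the third because `a
    -- ∈ Z`.
    have e2 : r ^ 2 = (r * e * r⁻¹)⁻¹ * (r * (e * r * e⁻¹)) * e := by rw [sq]; group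
    refine commute_of_commute_pow hp hr (m := 2) (fun hd => ?_) ?_
    · have := Nat.le_of_dvd (by norm_num) hd
      omega
    · refine mul_inv_eq_iff_eq_mul.1 ?_
      calc r ^ 2 * a * (r ^ 2)⁻¹ = (r * e * r⁻¹)⁻¹ * ((r * (e * r * e⁻¹)) * (e * a * e⁻¹) *
            (r * (e * r * e⁻¹))⁻¹) * (r * e * r⁻¹) := by rw [e2]; group
        _ = a := by rw [h1, h3 _ her, h2]
  · rw [Subgroup.inf_relIndex_right]
    exact Subgroup.relIndex_inf_le.trans (Nat.mul_le_mul hDZ hDZ')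

/-- A pushing-up statement for a `2`-local amalgam of dihedral type: if no nontrivial subgroup of
`P` is normalised by both `r` and `t`, then `K` meets its `t`-conjugate trivially. -/
theorem eq_one_of_mem_of_conj_mem {A : Type*} [Group A] [Finite A] {p : ℕ} (hp : p.Prime)
    (h5 : 5 ≤ p) {P K : Subgroup A} {r t : A} (hKP : K ≤ P) (hr : r ^ p = 1) (ht : t * t = 1)
    (htP : ∀ a ∈ P, t * a * t⁻¹ ∈ P) (hrK : ∀ a ∈ K, r * a * r⁻¹ ∈ K)
    (h2 : ∀ a ∈ P, ∃ n, a ^ 2 ^ n = 1)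
    (hrefl : ∀ a ∈ P, a ∉ K → r * (a * r * a⁻¹) ∈ K)
    (hidx : ∀ a ∈ P, ∀ b ∈ P, a ∉ K → b ∉ K → a * b⁻¹ ∈ K)
    (hcore : ∀ N ≤ P, (∀ a ∈ N, r * a * r⁻¹ ∈ N) → (∀ a ∈ N, t * a * t⁻¹ ∈ N) → N = ⊥)
    {a : A} (ha : a ∈ K) (hta : t * a * t⁻¹ ∈ K) : a = 1 := by
  have h2K : ∀ a ∈ K, ∃ n, a ^ 2 ^ n = 1 := fun a ha => h2 a (hKP ha)
  have hidx2 := relIndex_le_two hidx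
  have httt : ∀ a, t * (t * a * t⁻¹) * t⁻¹ = a := fun a => by
    calc t * (t * a * t⁻¹) * t⁻¹ = (t * t) * a * (t * t)⁻¹ := by group
      _ = a := by rw [ht]; simp
  set Z : Subgroup A := P ⊓ Subgroup.centralizer P with hZ
  have memZ : ∀ {a}, a ∈ Z ↔ a ∈ P ∧ ∀ b ∈ P, a * b = b * a := by
    intro a
    rw [hZ, Subgroup.mem_inf, Subgroup.mem_centralizer_iff]
    exact and_congr_right fun _ => ⟨fun h b hb => (h b hb).symm, fun h b hb => (h b hb).symm⟩
  by_cases hZK : Z ≤ K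
  · -- the centre lies in `K`
    suffices hP : P = ⊥ by
      have := hKP ha
      rwa [hP, Subgroup.mem_bot] at this
    -- If `r` centralises the centre of `P`, that centre is normalised by `r` and `t`, hence
    -- trivial; a 2-group with trivial centre is trivial.
    have key : (∀ z ∈ Z, Commute r z) → P = ⊥ := by
      intro hc
      have hZ1 : Z = ⊥ := by
        refine hcore Z inf_le_left (fun a ha => ?_) (fun a ha => ?_)
        · have : r * a * r⁻¹ = a := by rw [(hc a ha).eq]; group
          rwa [this]
        · rw [memZ] at ha ⊢
          refine ⟨htP a ha.1, fun b hb => ?_⟩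
          have h := ha.2 _ (htP b hb)
          have hb' := httt b
          calc t * a * t⁻¹ * b = t * a * t⁻¹ * (t * (t * b * t⁻¹) * t⁻¹) := by rw [hb']
            _ = t * (a * (t * b * t⁻¹)) * t⁻¹ := by group
            _ = (t * (t * b * t⁻¹) * t⁻¹) * (t * a * t⁻¹) := by rw [h]; group
            _ = _ := by rw [hb']
      by_contra hP
      have : Nontrivial P := (Subgroup.nontrivial_iff_ne_bot P).2 hP
      have : Fact (Nat.Prime 2) := ⟨Nat.prime_two⟩
      have hpg : IsPGroup 2 P := by
        rintro ⟨g, hg⟩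
        obtain ⟨n, hn⟩ := h2 g hg
        exact ⟨n, Subtype.ext (by simpa using hn)⟩
      obtain ⟨c, hcc, hne⟩ := (Subgroup.nontrivial_iff_exists_ne_one _).1 hpg.center_nontrivial
      have : (c : A) ∈ Z := memZ.2 ⟨c.2, fun b hb => by
        have := Subgroup.mem_center_iff.1 hcc ⟨b, hb⟩
        exact (congrArg Subtype.val this).symm⟩
      rw [hZ1, Subgroup.mem_bot] at this
      exact hne (Subtype.ext this)
    set S : Set (Subgroup A) := {E | E ≤ P ∧ ∀ a ∈ E, ∀ b ∈ E, a * b = b * a} with hS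
    obtain ⟨E₀, hE₀, hmax⟩ := Set.Finite.exists_maximalFor (fun E : Subgroup A => Nat.card E) S
      (Set.toFinite S) ⟨⊥, bot_le, fun a ha b hb => by
        rw [Subgroup.mem_bot] at ha hb
        rw [ha, hb]⟩
    have hmax' : ∀ F ∈ S, Nat.card F ≤ Nat.card E₀ := fun F hF => by
      by_contra h
      exact h (hmax hF (not_le.1 h).le)
    -- `sSup M` is the Thompson subgroup of `P`. If all of `M` lies in `K`, both `r` and `t` permute
    -- `M`, so `sSup M` is trivial, which forces `P = ⊥`.
    set M : Set (Subgroup A) := {E | E ∈ S ∧ Nat.card E = Nat.card E₀} with hM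
    by_cases hMK : ∀ E ∈ M, E ≤ K
    · have hconj : ∀ g : A, (∀ a ∈ K, g * a * g⁻¹ ∈ P) →
          ∀ a ∈ sSup M, g * a * g⁻¹ ∈ sSup M := by
        intro g hg
        have hle : sSup M ≤ (sSup M).comap (MulAut.conj g).toMonoidHom := by
          refine sSup_le fun E hE => ?_
          have hE' : E.map (MulAut.conj g).toMonoidHom ∈ M := by
            refine ⟨⟨?_, ?_⟩, ?_⟩
            · rintro _ ⟨a, ha, rfl⟩
              exact hg a (hMK E hE ha)
            · rintro _ ⟨a, ha, rfl⟩ _ ⟨b, hb, rfl⟩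
              rw [← map_mul, hE.1.2 a ha b hb, map_mul]
            · rw [← hE.2]
              exact Subgroup.card_map_of_injective (MulAut.conj g).injective
          exact Subgroup.map_le_iff_le_comap.1 (le_sSup hE')
        exact fun a ha => hle ha
      have hJ : sSup M = ⊥ := by
        refine hcore _ (sSup_le fun E hE => hE.1.1) ?_ ?_
        · exact hconj r fun a ha => hKP (hrK a ha)
        · exact hconj t fun a ha => htP a (hKP ha)
      have hE₀1 : E₀ = ⊥ := le_bot_iff.1 (hJ ▸ le_sSup ⟨hE₀, rfl⟩)
      rw [eq_bot_iff]
      intro b hb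
      have h := hmax' (Subgroup.zpowers b) ⟨by simpa using hb, by
        rintro _ ⟨i, rfl⟩ _ ⟨j, rfl⟩
        exact (Commute.refl b).zpow_zpow i j⟩
      rw [hE₀1, Subgroup.card_bot] at h
      have := Subgroup.eq_bot_of_card_le _ h
      rwa [Subgroup.zpowers_eq_bot] at this
    · push Not at hMK
      obtain ⟨E, hE, hEK⟩ := hMK
      obtain ⟨e, he, heK⟩ := SetLike.not_le_iff_exists.1 hEK
      refine key fun z hz => ?_
      exact commute_of_maximal_abelian_not_le hp h5 hKP hE.1.1 hr hrK h2K hidx2 hE.1.2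
        (fun F hF hF' => hE.2 ▸ hmax' F ⟨hF, hF'⟩) he (hrefl e (hE.1.1 he) heK) (hZK hz)
        fun b hb => (memZ.1 hz).2 b (hKP hb)
  · obtain ⟨z, hz, hzK⟩ := SetLike.not_le_iff_exists.1 hZK
    have hc := commute_of_center_not_le hp h5 hr hrK h2K
      (fun b hb => (memZ.1 hz).2 b (hKP hb)) (hrefl z (memZ.1 hz).1 hzK)
    -- With `r` centralising `K`, every subgroup of `K` is normalised by `r`; this one is also
    -- swapped into itself by the involution `t`.
    have hN : K ⊓ K.comap (MulAut.conj t).toMonoidHom = ⊥ := by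
      refine hcore _ (inf_le_left.trans hKP) (fun b hb => ?_) (fun b hb => ?_)
      · have : r * b * r⁻¹ = b := by rw [(hc b hb.1).eq]; group
        rwa [this]
      · refine ⟨hb.2, ?_⟩
        change t * (t * b * t⁻¹) * t⁻¹ ∈ K
        rw [httt]
        exact hb.1
    have : a ∈ K ⊓ K.comap (MulAut.conj t).toMonoidHom := ⟨ha, hta⟩
    rwa [hN, Subgroup.mem_bot] at this

/-- Under the hypotheses of `eq_one_of_mem_of_conj_mem`, the order of `P` is at most `4`. -/
theorem card_le_four {A : Type*} [Group A] [Finite A] {p : ℕ} (hp : p.Prime)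
    (h5 : 5 ≤ p) {P K : Subgroup A} {r t : A} (hKP : K ≤ P) (hr : r ^ p = 1) (ht : t * t = 1)
    (htP : ∀ a ∈ P, t * a * t⁻¹ ∈ P) (hrK : ∀ a ∈ K, r * a * r⁻¹ ∈ K)
    (h2 : ∀ a ∈ P, ∃ n, a ^ 2 ^ n = 1)
    (hrefl : ∀ a ∈ P, a ∉ K → r * (a * r * a⁻¹) ∈ K)
    (hidx : ∀ a ∈ P, ∀ b ∈ P, a ∉ K → b ∉ K → a * b⁻¹ ∈ K)
    (hcore : ∀ N ≤ P, (∀ a ∈ N, r * a * r⁻¹ ∈ N) → (∀ a ∈ N, t * a * t⁻¹ ∈ N) → N = ⊥) :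
    Nat.card P ≤ 4 := by
  set L : Subgroup A := K.comap (MulAut.conj t).toMonoidHom with hL
  have hLP : L.relIndex P ≤ 2 := by
    refine relIndex_le_two fun a ha b hb haL hbL => ?_
    have := hidx _ (htP a ha) _ (htP b hb) haL hbL
    change t * (a * b⁻¹) * t⁻¹ ∈ K
    convert this using 1
    group
  have hbot : K ⊓ L = ⊥ := (Subgroup.eq_bot_iff_forall _).2 fun a ha =>
    eq_one_of_mem_of_conj_mem hp h5 hKP hr ht htP hrK h2 hrefl hidx hcore ha.1 ha.2
  have h := Subgroup.relIndex_inf_le (H := K) (K := L) (L := P)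
  rw [hbot, Subgroup.relIndex_bot_left] at h
  exact h.trans (Nat.mul_le_mul (relIndex_le_two hidx) hLP)

/-! ### Translations and group automorphisms inside `Aut Γ`. -/

/-- Right translations are automorphisms of every Cayley graph. -/
def rightMulIso {G : Type*} [Group G] (S : Set G) : G →* (cayleyGraph S ≃g cayleyGraph S) where
  toFun g :=
    { toEquiv := Equiv.mulRight g⁻¹
      map_rel_iff' := by
        intro u v
        simp [cayleyGraph] }
  map_one' := by ext u; simp
  map_mul' g h := by
    ext u
    change u * (g * h)⁻¹ = u * h⁻¹ * g⁻¹
    rw [mul_inv_rev, mul_assoc]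

@[simp] theorem rightMulIso_apply {G : Type*} [Group G] (S : Set G) (g u : G) :
    rightMulIso S g u = u * g⁻¹ := rfl

@[simp] theorem rightMulIso_inv_apply {G : Type*} [Group G] (S : Set G) (g u : G) :
    (rightMulIso S g)⁻¹ u = u * g := by
  rw [← map_inv, rightMulIso_apply, inv_inv]

theorem autStabilizer_eq_bot_of_isGRR {G : Type*} [Group G] {S : Set G}
    (h : IsGRR (cayleyGraph S) G) : autStabilizer G S = ⊥ := by
  rw [Subgroup.eq_bot_iff_forall]
  intro α hα
  have hα : α '' S = S := hα
  have hmem : ∀ g, α g ∈ S ↔ g ∈ S := fun g => by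
    conv_lhs => rw [← hα]
    exact α.injective.mem_set_image
  let φ : cayleyGraph S ≃g cayleyGraph S :=
    { toEquiv := α.toEquiv
      map_rel_iff' := by
        intro u v
        change (α u ≠ α v ∧ (α v * (α u)⁻¹ ∈ S ∨ α u * (α v)⁻¹ ∈ S)) ↔ _
        rw [← map_inv, ← map_inv, ← map_mul, ← map_mul, hmem, hmem, α.injective.ne_iff]
        rfl }
  have h1 : φ = 1 := (h.2.1 1 1).unique (map_one α) rfl
  ext g
  exact congrArg (fun ψ : cayleyGraph S ≃g cayleyGraph S => ψ g) h1

theorem isGRR_of_forall_eq_one {G : Type*} [Group G] {S : Set G}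
    (h : ∀ φ : cayleyGraph S ≃g cayleyGraph S, φ 1 = 1 → φ = 1) : IsGRR (cayleyGraph S) G := by
  have key : ∀ φ : cayleyGraph S ≃g cayleyGraph S, φ = rightMulIso S (φ 1)⁻¹ := fun φ => by
    have := h ((rightMulIso S (φ 1)) * φ) (by simp)
    rw [mul_eq_one_iff_inv_eq, ← map_inv] at this
    exact this.symm
  refine ⟨⟨1⟩, fun u v => ⟨rightMulIso S (v⁻¹ * u), by simp, fun φ hφ => ?_⟩, ?_⟩
  · rw [key φ]
    congr 1
    rw [← hφ, key φ]
    simp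
  · refine ⟨MulEquiv.ofBijective (rightMulIso S) ⟨fun g g' hg => ?_, fun φ => ⟨_, (key φ).symm⟩⟩⟩
    simpa using congrArg (fun ψ : cayleyGraph S ≃g cayleyGraph S => ψ 1) hg

theorem eq_one_of_map_mul {G : Type*} [Group G] {S : Set G} (h1 : (1 : G) ∉ S)
    (hinv : ∀ s ∈ S, s⁻¹ ∈ S) (hS : autStabilizer G S = ⊥)
    {φ : cayleyGraph S ≃g cayleyGraph S} (hφ1 : φ 1 = 1) (hφ : ∀ u v, φ (u * v) = φ u * φ v) :
    φ = 1 := by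
  let α : MulAut G := { φ.toEquiv with map_mul' := hφ }
  have hα : α ∈ autStabilizer G S := by
    have hm : ∀ g, φ g ∈ S ↔ g ∈ S := fun g => by
      have := φ.map_rel_iff (a := 1) (b := g)
      rw [cayleyGraph_adj_iff h1 hinv, cayleyGraph_adj_iff h1 hinv, hφ1] at this
      simpa using this
    change φ '' S = S
    ext g
    constructor
    · rintro ⟨s, hs, rfl⟩
      exact (hm s).2 hs
    · intro hg
      obtain ⟨s, rfl⟩ := φ.surjective g
      exact ⟨s, (hm s).1 hg, rfl⟩
  rw [hS, Subgroup.mem_bot] at hα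
  ext g
  exact congrArg (fun β : MulAut G => β g) hα

/-- A map commuting with left multiplication by a generating set, up to replacing generators, is
multiplicative as soon as it fixes `1`. -/
theorem map_mul_of_generators {G : Type*} [Group G] {T : Set G}
    (hT : Subgroup.closure T = ⊤) {f : G → G} (hf1 : f 1 = 1)
    (hf : ∀ t ∈ T, ∃ c, ∀ u, f (t * u) = c * f u) (u v : G) : f (u * v) = f u * f v := by
  have h : ∃ c, ∀ v, f (u * v) = c * f v := by
    have hu : u ∈ Subgroup.closure T := hT ▸ Subgroup.mem_top u
    induction hu using Subgroup.closure_induction with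
    | mem t ht => exact hf t ht
    | one => exact ⟨1, by simp⟩
    | mul a b _ _ iha ihb =>
      obtain ⟨c, hc⟩ := iha
      obtain ⟨d, hd⟩ := ihb
      exact ⟨c * d, fun v => by rw [mul_assoc, hc, hd, mul_assoc]⟩
    | inv a _ ih =>
      obtain ⟨c, hc⟩ := ih
      exact ⟨c⁻¹, fun v => by rw [eq_inv_mul_iff_mul_eq, ← hc, mul_inv_cancel_left]⟩
  obtain ⟨c, hc⟩ := h
  have hcu : f u = c := by simpa [hf1] using hc 1
  rw [hc, hcu]

/-- A subgroup of index at most `4` without proper subgroups of index less than `4` is normal. -/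
theorem conj_mem_of_index_le_four {A : Type*} [Group A] [Finite A] (B : Subgroup A)
    (hB : B.index ≤ 4) (hidx : ∀ H : Subgroup B, H ≠ ⊤ → 4 ≤ H.index) (a : A) {b : A}
    (hb : b ∈ B) : a⁻¹ * b * a ∈ B := by
  set q : A ⧸ B := QuotientGroup.mk a with hq
  have hcard : Nat.card (MulAction.orbit B q) = (MulAction.stabilizer B q).index :=
    (MulAction.index_stabilizer B q).symm
  by_cases ha : a ∈ B
  · exact B.mul_mem (B.mul_mem (B.inv_mem ha) hb) ha
  have htop : MulAction.stabilizer B q = ⊤ := by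
    by_contra hne
    have h4 := hidx _ hne
    rw [← hcard, Nat.card_coe_set_eq] at h4
    -- The base coset is fixed by `B`, so a nontrivial orbit, having at least four points, would
    -- leave no room for it among at most four cosets.
    have hone : (QuotientGroup.mk 1 : A ⧸ B) ∉ MulAction.orbit B q := by
      rintro ⟨c, hc⟩
      have hc : (QuotientGroup.mk (c * a) : A ⧸ B) = QuotientGroup.mk 1 := hc
      rw [QuotientGroup.eq] at hc
      refine ha ?_
      have : (c * a : A) ∈ B := by simpa using B.inv_mem hc
      exact (B.mul_mem_cancel_left c.2).1 this
    have h5 : (insert (QuotientGroup.mk 1 : A ⧸ B) (MulAction.orbit B q)).ncard ≤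
        Nat.card (A ⧸ B) := Set.ncard_le_card _
    rw [Set.ncard_insert_of_notMem hone] at h5
    have : Nat.card (A ⧸ B) ≤ 4 := hB
    omega
  have h : (⟨b⁻¹, B.inv_mem hb⟩ : B) ∈ MulAction.stabilizer B q := htop ▸ Subgroup.mem_top _
  have h : (QuotientGroup.mk (b⁻¹ * a) : A ⧸ B) = QuotientGroup.mk a := h
  rw [QuotientGroup.eq] at h
  simpa [mul_assoc] using h

/-- Translations are transitive on vertices, so every coset of their group meets the stabiliser of
`1`. -/
theorem index_range_rightMulIso_le {G : Type*} [Group G] [Finite G] {S : Set G}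
    {P : Subgroup (cayleyGraph S ≃g cayleyGraph S)} (hP : ∀ φ, φ 1 = 1 → φ ∈ P) :
    (rightMulIso S).range.index ≤ Nat.card P := by
  have : Finite (cayleyGraph S ≃g cayleyGraph S) := Finite.of_injective _ DFunLike.coe_injective
  refine Nat.card_le_card_of_surjective
    (fun φ : P => (QuotientGroup.mk φ.1 : _ ⧸ (rightMulIso S).range)) fun q => ?_
  obtain ⟨φ, rfl⟩ := QuotientGroup.mk_surjective q
  set g := φ⁻¹ 1 with hg
  have hφg : φ g = 1 := φ.apply_symm_apply 1
  refine ⟨⟨φ * rightMulIso S g⁻¹, hP _ (by simpa using hφg)⟩, ?_⟩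
  rw [QuotientGroup.eq]
  exact ⟨g, by simp⟩

/-- If the stabiliser of the vertex `1` has order at most `4` and `G` has no proper subgroup of
index less than `4`, then that stabiliser acts by group automorphisms. -/
theorem map_mul_of_card_le_four {G : Type*} [Group G] [Finite G] {S : Set G}
    (hindex : ∀ H : Subgroup G, H ≠ ⊤ → 4 ≤ H.index)
    {P : Subgroup (cayleyGraph S ≃g cayleyGraph S)} (hP : ∀ φ, φ 1 = 1 → φ ∈ P)
    (hcard : Nat.card P ≤ 4) {φ : cayleyGraph S ≃g cayleyGraph S} (hφ : φ 1 = 1) (u v : G) :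
    φ (u * v) = φ u * φ v := by
  have : Finite (cayleyGraph S ≃g cayleyGraph S) := Finite.of_injective _ DFunLike.coe_injective
  have hidx : ∀ H : Subgroup (rightMulIso S).range, H ≠ ⊤ → 4 ≤ H.index := by
    intro H hH
    have hs := (rightMulIso S).rangeRestrict_surjective
    rw [← Subgroup.index_comap_of_surjective H hs]
    refine hindex _ fun h => hH ?_
    rw [← Subgroup.map_comap_eq_self_of_surjective hs H, h, ← MonoidHom.range_eq_map,
      MonoidHom.range_eq_top.2 hs]
  obtain ⟨w, hw⟩ := conj_mem_of_index_le_four _ ((index_range_rightMulIso_le hP).trans hcard)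
    hidx φ⁻¹ (b := rightMulIso S v⁻¹) ⟨v⁻¹, rfl⟩
  rw [inv_inv] at hw
  -- By normality, conjugating right translation by `v` with `φ` gives another right translation.
  -- Evaluating at `φ 1 = 1` identifies its factor as `φ v`.
  have happ : ∀ t, φ (φ⁻¹ t * v) = t * w⁻¹ := fun t => by
    have := congrArg (fun ψ : cayleyGraph S ≃g cayleyGraph S => ψ t) hw
    simpa using this.symm
  have h1 := happ (φ 1)
  have hu := happ (φ u)
  have hi : ∀ g, φ⁻¹ (φ g) = g := φ.symm_apply_apply
  rw [hi] at h1 hu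
  rw [hu]
  rw [hφ, one_mul, one_mul] at h1
  rw [h1]

/-! ### Words in `x` and `y`, and membership in `S`. -/

theorem mul_self_eq_one_of_sq {G : Type*} [Group G] {y : G} (hy : y ^ 2 = 1) : y * y = 1 := by
  rw [← sq, hy]

theorem ne_one_of_conj_notMem {G : Type*} [Group G] {x y : G} (hy : y ^ 2 = 1)
    (hxy : y * x * y ∉ Subgroup.zpowers x) : x ≠ 1 := by
  rintro rfl
  exact hxy (by simp [mul_self_eq_one_of_sq hy])

theorem zpow_eq_one_iff_dvd {G : Type*} [Group G] {p : ℕ} (hp : p.Prime) {x : G}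
    (hx : x ^ p = 1) (hx1 : x ≠ 1) {n : ℤ} : x ^ n = 1 ↔ (p : ℤ) ∣ n := by
  have := Fact.mk hp
  rw [← orderOf_eq_prime hx hx1, orderOf_dvd_iff_zpow_eq_one]

theorem dvd_of_conj_zpow_mem {G : Type*} [Group G] {p : ℕ} (hp : p.Prime) {x y : G}
    (hx : x ^ p = 1) (hy : y ^ 2 = 1) (hxy : y * x * y ∉ Subgroup.zpowers x) {n : ℤ}
    (h : y * x ^ n * y ∈ Subgroup.zpowers x) : (p : ℤ) ∣ n := by
  by_contra hn
  have hyi : y⁻¹ = y := inv_eq_of_mul_eq_one_left (mul_self_eq_one_of_sq hy)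
  obtain ⟨a, b, hab⟩ := (Int.prime_iff_natAbs_prime.2 (by simpa using hp) :
    Prime (p : ℤ)).coprime_iff_not_dvd.2 hn
  have e : x = (x ^ n) ^ b := by
    rw [← zpow_mul, mul_comm n b]
    have : b * n = 1 - p * a := by linear_combination hab
    rw [this, zpow_sub, zpow_mul, zpow_natCast, hx]
    simp
  refine hxy ?_
  have := Subgroup.zpow_mem _ h b
  nth_rw 2 [← hyi] at this
  rw [conj_zpow, ← e, hyi] at this
  exact this

theorem mul_mul_notMem_zpowers {G : Type*} [Group G] {x y : G}
    (hxy : y * x * y ∉ Subgroup.zpowers x) (a b : ℤ) :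
    x ^ a * y * x ^ b ∉ Subgroup.zpowers x := by
  have hpow : ∀ n : ℤ, x ^ n ∈ Subgroup.zpowers x := fun n => ⟨n, rfl⟩
  rw [Subgroup.mul_mem_cancel_right _ (hpow b), Subgroup.mul_mem_cancel_left _ (hpow a)]
  intro hy
  exact hxy (mul_mem (mul_mem hy (Subgroup.mem_zpowers x)) hy)

/-- The exponents in `x ^ a * y * x ^ b` are determined modulo `p`, because `y` conjugates no
nontrivial power of `x` into `⟨x⟩`. In particular `a + b` is an invariant modulo `p`, equal to `0`
for the involutions of `S`. -/
theorem dvd_of_mul_mul_eq {G : Type*} [Group G] {p : ℕ} (hp : p.Prime) {x y : G}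
    (hx : x ^ p = 1) (hy : y ^ 2 = 1) (hxy : y * x * y ∉ Subgroup.zpowers x) {a b c e : ℤ}
    (h : x ^ a * y * x ^ b = x ^ c * y * x ^ e) : (p : ℤ) ∣ a - c ∧ (p : ℤ) ∣ b - e := by
  have hyy := mul_self_eq_one_of_sq hy
  have hyi : y⁻¹ = y := inv_eq_of_mul_eq_one_left hyy
  have h1 : y * x ^ (b - e) * y = x ^ (c - a) := by
    calc y * x ^ (b - e) * y = y * x ^ (b - e) * y⁻¹ := by rw [hyi]
      _ = (x ^ a)⁻¹ * (x ^ a * y * x ^ b) * (x ^ e)⁻¹ * y⁻¹ := by rw [zpow_sub]; group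
      _ = _ := by rw [h, zpow_sub]; group
  have h2 := dvd_of_conj_zpow_mem hp hx hy hxy (n := b - e) ⟨c - a, h1.symm⟩
  have hx1 := ne_one_of_conj_notMem hy hxy
  refine ⟨?_, h2⟩
  rw [(zpow_eq_one_iff_dvd hp hx hx1).2 h2, mul_one, hyy] at h1
  have := (zpow_eq_one_iff_dvd hp hx hx1).1 h1.symm
  rwa [← dvd_neg, neg_sub] at this

theorem mem_powersR_iff {G : Type*} [Group G] {k : ℕ} {x g : G} :
    g ∈ powersR k x ↔ ∃ i : ℤ, i ≠ 0 ∧ |i| ≤ ((k - 1) / 2 : ℕ) ∧ g = x ^ i := by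
  constructor
  · rintro ⟨j, h1, h2, rfl | rfl⟩
    · exact ⟨j, by omega, by rw [Nat.abs_cast]; exact_mod_cast h2, by simp⟩
    · exact ⟨-j, by omega, by rw [abs_neg, Nat.abs_cast]; exact_mod_cast h2, by simp⟩
  · rintro ⟨i, h1, h2, rfl⟩
    rw [Int.abs_eq_natAbs] at h2
    refine ⟨i.natAbs, by omega, by omega, ?_⟩
    rcases Int.natAbs_eq i with h | h
    · left
      nth_rw 1 [h]
      rw [zpow_natCast]
    · right
      nth_rw 1 [h]
      rw [zpow_neg, zpow_natCast]

theorem mem_connectionSet_iff {G : Type*} [Group G] {k : ℕ} {x y g : G} :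
    g ∈ connectionSet k x y ↔ (∃ i : ℤ, i ≠ 0 ∧ |i| ≤ ((k - 1) / 2 : ℕ) ∧ g = x ^ i) ∨
      g = y ∨ (Even k ∧ g = x⁻¹ * y * x) := by
  unfold connectionSet
  split_ifs with hk
  · have : ¬ Even k := Nat.not_even_iff_odd.2 hk
    simp [mem_powersR_iff, this, or_comm]
  · have : Even k := Nat.not_odd_iff_even.1 hk
    simp only [Set.mem_union, mem_powersR_iff, Set.mem_insert_iff, Set.mem_singleton_iff, this,
      true_and]

/-- The range `2d` covers differences of two exponents from `S`. Comparing with an exponent at most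
`d` needs `3d < p`, which is where the bound on `p` comes from. -/
theorem zpow_mem_connectionSet_iff {G : Type*} [Group G] {k p : ℕ} (hp : p.Prime)
    (hpk : 3 * ((k - 1) / 2) + 1 ≤ p) {x y : G} (hx : x ^ p = 1) (hy : y ^ 2 = 1)
    (hxy : y * x * y ∉ Subgroup.zpowers x) {i : ℤ} (hi : |i| ≤ 2 * ((k - 1) / 2 : ℕ)) :
    x ^ i ∈ connectionSet k x y ↔ i ≠ 0 ∧ |i| ≤ ((k - 1) / 2 : ℕ) := by
  rw [mem_connectionSet_iff]
  constructor
  · rintro (⟨j, hj0, hj, he⟩ | h | ⟨-, h⟩)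
    · have h1 : x ^ (i - j) = 1 := by rw [zpow_sub, he, mul_inv_cancel]
      rw [zpow_eq_one_iff_dvd hp hx (ne_one_of_conj_notMem hy hxy)] at h1
      have h2 : i - j = 0 := by
        refine Int.eq_zero_of_abs_lt_dvd h1 ?_
        have h3 := abs_sub i j
        have : (3 * ((k - 1) / 2 : ℕ) + 1 : ℤ) ≤ p := by exact_mod_cast hpk
        omega
      have : i = j := by omega
      rw [this]
      exact ⟨hj0, hj⟩
    · have := mul_mul_notMem_zpowers hxy 0 0
      rw [zpow_zero, one_mul, mul_one, ← h] at this
      exact absurd ⟨i, rfl⟩ this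
    · have := mul_mul_notMem_zpowers hxy (-1) 1
      rw [zpow_neg_one, zpow_one, ← h] at this
      exact absurd ⟨i, rfl⟩ this
  · exact fun h => Or.inl ⟨i, h.1, h.2, rfl⟩

/-! ### Triangle counts on the edges of each label. -/

/-- The common neighbours of `1` and `g` in `Cay(G, S)`. -/
def commonNeighborsOne {G : Type*} [Group G] (S : Set G) (g : G) : Set G :=
  {w | w ∈ S ∧ w * g⁻¹ ∈ S}

theorem ncard_commonNeighbors_cayleyGraph {G : Type*} [Group G] {S : Set G} (h1 : (1 : G) ∉ S)
    (hinv : ∀ s ∈ S, s⁻¹ ∈ S) (u v : G) :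
    ((cayleyGraph S).commonNeighbors u v).ncard = (commonNeighborsOne S (v * u⁻¹)).ncard := by
  rw [← Set.ncard_image_of_injective (commonNeighborsOne S (v * u⁻¹)) (mul_left_injective u)]
  congr 1
  ext w
  simp only [SimpleGraph.mem_commonNeighbors, cayleyGraph_adj_iff h1 hinv, Set.mem_image,
    commonNeighborsOne]
  constructor
  · rintro ⟨ha, hb⟩
    exact ⟨w * u⁻¹, ⟨ha, by simpa [mul_assoc] using hb⟩, by simp⟩
  · rintro ⟨a, ⟨ha, hb⟩, rfl⟩
    exact ⟨by simpa using ha, by simpa [mul_assoc] using hb⟩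

theorem ncard_commonNeighbors_map {V : Type*} {Γ : SimpleGraph V} (φ : Γ ≃g Γ) (u v : V) :
    (Γ.commonNeighbors (φ u) (φ v)).ncard = (Γ.commonNeighbors u v).ncard := by
  rw [← Set.ncard_image_of_injective (Γ.commonNeighbors u v) φ.injective]
  congr 1
  ext w
  simp only [SimpleGraph.mem_commonNeighbors, Set.mem_image]
  constructor
  · rintro ⟨ha, hb⟩
    obtain ⟨w, rfl⟩ := φ.surjective w
    exact ⟨w, ⟨φ.map_rel_iff.1 ha, φ.map_rel_iff.1 hb⟩, rfl⟩
  · rintro ⟨w, ⟨ha, hb⟩, rfl⟩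
    exact ⟨φ.map_rel_iff.2 ha, φ.map_rel_iff.2 hb⟩

theorem le_ncard_commonNeighborsOne {G : Type*} [Group G] [Finite G] {k p : ℕ} (hp : p.Prime)
    (hpk : 3 * ((k - 1) / 2) + 1 ≤ p) (hk : 5 ≤ k) {x y : G} (hx : x ^ p = 1) (hy : y ^ 2 = 1)
    (hxy : y * x * y ∉ Subgroup.zpowers x) :
    2 * ((k - 1) / 2) - 2 ≤ (commonNeighborsOne (connectionSet k x y) x).ncard := by
  set d := (k - 1) / 2 with hd
  have hd2 : 2 ≤ d := by omega
  -- These are the `i` for which both `i` and `i - 1` are nonzero of absolute value at most `d`.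
  set F : Finset ℤ := ((Finset.Icc (1 - d : ℤ) d).erase 0).erase 1 with hF
  have hcard : F.card = 2 * d - 2 := by
    rw [hF, Finset.card_erase_of_mem, Finset.card_erase_of_mem, Int.card_Icc]
    · omega
    · rw [Finset.mem_Icc]; omega
    · rw [Finset.mem_erase, Finset.mem_Icc]; omega
  have hmem : ∀ i ∈ F, i ≠ 0 ∧ i ≠ 1 ∧ 1 - (d : ℤ) ≤ i ∧ i ≤ d := by
    intro i hi
    rw [hF, Finset.mem_erase, Finset.mem_erase, Finset.mem_Icc] at hi
    exact ⟨hi.2.1, hi.1, hi.2.2⟩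
  have hinj : Set.InjOn (fun i : ℤ => x ^ i) F := by
    intro i hi j hj hij
    have h1 : x ^ (i - j) = 1 := by rw [zpow_sub]; exact mul_inv_eq_one.2 hij
    rw [zpow_eq_one_iff_dvd hp hx (ne_one_of_conj_notMem hy hxy)] at h1
    have := hmem i hi
    have := hmem j hj
    have h2 : i - j = 0 := Int.eq_zero_of_abs_lt_dvd h1 (by rw [abs_lt]; omega)
    omega
  rw [← hcard, ← Set.ncard_coe_finset, ← hinj.ncard_image]
  refine Set.ncard_le_ncard ?_ (Set.toFinite _)
  rintro _ ⟨i, hi, rfl⟩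
  have := hmem i hi
  refine ⟨(zpow_mem_connectionSet_iff hp hpk hx hy hxy ?_).2 ⟨by omega, ?_⟩, ?_⟩
  · rw [abs_le]; omega
  · rw [abs_le]; omega
  · have e : x ^ i * x⁻¹ = x ^ (i - 1) := by rw [zpow_sub_one]
    change x ^ i * x⁻¹ ∈ _
    rw [e, zpow_mem_connectionSet_iff hp hpk hx hy hxy]
    · exact ⟨by omega, by rw [abs_le]; omega⟩
    · rw [abs_le]; omega

theorem ncard_commonNeighborsOne_zpow_le {G : Type*} [Group G] [Finite G] {k p : ℕ}
    (hp : p.Prime) (hpk : 3 * ((k - 1) / 2) + 1 ≤ p) {x y : G} (hx : x ^ p = 1)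
    (hy : y ^ 2 = 1) (hxy : y * x * y ∉ Subgroup.zpowers x) {j : ℤ} (hj2 : 2 ≤ |j|)
    (hjd : |j| ≤ ((k - 1) / 2 : ℕ)) :
    (commonNeighborsOne (connectionSet k x y) (x ^ j)).ncard ≤ 2 * ((k - 1) / 2) - 3 := by
  set d := (k - 1) / 2 with hd
  -- The two intervals of radius `d` about `0` and `j` share `2d + 1 - |j|` integers; removing `0`
  -- and `j` leaves `2d - 1 - |j| ≤ 2d - 3`.
  set F : Finset ℤ := ((Finset.Icc (max (-d : ℤ) (j - d)) (min d (j + d))).erase 0).erase j with hF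
  have hja := abs_cases j
  have hcard : F.card ≤ 2 * d - 3 := by
    rw [hF, Finset.card_erase_of_mem, Finset.card_erase_of_mem, Int.card_Icc]
    · omega
    · rw [Finset.mem_Icc]; omega
    · rw [Finset.mem_erase, Finset.mem_Icc]; omega
  have hjp : ¬ (p : ℤ) ∣ j := by
    intro h
    have := Int.eq_zero_of_abs_lt_dvd h (by omega)
    omega
  have hconj : ∀ a b : ℤ, x ^ a * y * x ^ (-a) * (x ^ j)⁻¹ ≠ x ^ b * y * x ^ (-b) := by
    intro a b h
    have h' : x ^ a * y * x ^ (-a - j) = x ^ b * y * x ^ (-b) := by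
      rw [← h, zpow_sub]; group
    have h2 := dvd_of_mul_mul_eq hp hx hy hxy h'
    refine hjp ?_
    have := (dvd_add h2.1 h2.2)
    rw [← dvd_neg]
    convert this using 1
    ring
  have hpow : ∀ a i : ℤ, x ^ a * y * x ^ (-a) * (x ^ j)⁻¹ ≠ x ^ i := by
    intro a i h
    refine mul_mul_notMem_zpowers hxy a (-a - j) ⟨i, ?_⟩
    change x ^ i = _
    rw [← h, zpow_sub]; group
  have e0 : y = x ^ (0 : ℤ) * y * x ^ (-0 : ℤ) := by simp
  have e1 : x⁻¹ * y * x = x ^ (-1 : ℤ) * y * x ^ (- -1 : ℤ) := by simp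
  have hsub : commonNeighborsOne (connectionSet k x y) (x ^ j) ⊆ (fun i : ℤ => x ^ i) '' F := by
    rintro w ⟨hw, hw'⟩
    have hno : ∀ a : ℤ, w ≠ x ^ a * y * x ^ (-a) := by
      rintro a rfl
      rcases mem_connectionSet_iff.1 hw' with ⟨i, -, -, h⟩ | h | ⟨-, h⟩
      · exact hpow a i h
      · exact hconj a 0 (h.trans e0)
      · exact hconj a (-1) (h.trans e1)
    rcases mem_connectionSet_iff.1 hw with ⟨i, hi0, hi, rfl⟩ | h | ⟨-, h⟩
    · refine ⟨i, ?_, rfl⟩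
      rw [← zpow_sub, zpow_mem_connectionSet_iff hp hpk hx hy hxy] at hw'
      · rw [abs_le] at hi hw'
        rw [hF, Finset.mem_coe, Finset.mem_erase, Finset.mem_erase, Finset.mem_Icc]
        omega
      · have := abs_sub i j
        omega
    · exact absurd (h.trans e0) (hno 0)
    · exact absurd (h.trans e1) (hno (-1))
  calc _ ≤ ((fun i : ℤ => x ^ i) '' (F : Set ℤ)).ncard := Set.ncard_le_ncard hsub (Set.toFinite _)
    _ ≤ (F : Set ℤ).ncard := Set.ncard_image_le (Set.toFinite _)
    _ ≤ _ := by rwa [Set.ncard_coe_finset]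

/-- In a triangle on an involution edge, one power of `x` with two involutions violates the
exponent-sum invariant or makes the involutions equal; two powers and one involution would put the
involution in `⟨x⟩`; three involutions drawn from only two would force one to be `1`. -/
theorem commonNeighborsOne_eq_empty {G : Type*} [Group G] {k p : ℕ} (hp : p.Prime)
    (hpk : 3 * ((k - 1) / 2) + 1 ≤ p) {x y : G} (hx : x ^ p = 1) (hy : y ^ 2 = 1)
    (hxy : y * x * y ∉ Subgroup.zpowers x) {g : G} (hg : g = y ∨ g = x⁻¹ * y * x) :
    commonNeighborsOne (connectionSet k x y) g = ∅ := by
  have hyy := mul_self_eq_one_of_sq hy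
  have hyi : y⁻¹ = y := inv_eq_of_mul_eq_one_left hyy
  have e0 : y = x ^ (0 : ℤ) * y * x ^ (-0 : ℤ) := by simp
  have e1 : x⁻¹ * y * x = x ^ (-1 : ℤ) * y * x ^ (- -1 : ℤ) := by simp
  have hy1 : y ≠ 1 := by
    rintro rfl
    exact hxy (by simp)
  have hz1 : x⁻¹ * y * x ≠ 1 := fun h => hy1 (by
    calc y = x * (x⁻¹ * y * x) * x⁻¹ := by group
      _ = 1 := by rw [h]; simp)
  have hzi : (x⁻¹ * y * x)⁻¹ = x⁻¹ * y * x := by simp [hyi, mul_assoc]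
  have hform : ∀ {w}, (w = y ∨ w = x⁻¹ * y * x) → w ≠ 1 ∧ w⁻¹ = w ∧
      ∃ c : ℤ, w = x ^ c * y * x ^ (-c) := by
    rintro w (rfl | rfl)
    · exact ⟨hy1, hyi, 0, e0⟩
    · exact ⟨hz1, hzi, -1, e1⟩
  have hSform : ∀ {w}, w ∈ connectionSet k x y → (∃ i : ℤ, ¬ (p : ℤ) ∣ i ∧ w = x ^ i) ∨
      (w = y ∨ w = x⁻¹ * y * x) := by
    intro w hw
    rcases mem_connectionSet_iff.1 hw with ⟨i, hi0, hi, h⟩ | h | ⟨-, h⟩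
    · refine Or.inl ⟨i, fun hd => hi0 (Int.eq_zero_of_abs_lt_dvd hd ?_), h⟩
      omega
    · exact Or.inr (Or.inl h)
    · exact Or.inr (Or.inr h)
  obtain ⟨hg1, hgi, c, hgc⟩ := hform hg
  rw [Set.eq_empty_iff_forall_notMem]
  rintro w ⟨hw, hw'⟩
  rw [hgi] at hw'
  rcases hSform hw with ⟨i, hi, rfl⟩ | hw
  · have e : x ^ i * g = x ^ (i + c) * y * x ^ (-c) := by
      rw [hgc, zpow_add]
      simp only [mul_assoc]
    rw [e] at hw'
    rcases hSform hw' with ⟨j, -, h⟩ | h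
    · exact mul_mul_notMem_zpowers hxy (i + c) (-c) (h ▸ ⟨j, rfl⟩)
    · obtain ⟨-, -, b, hb⟩ := hform h
      have h2 := dvd_of_mul_mul_eq hp hx hy hxy hb
      have h3 := dvd_add h2.1 h2.2
      rw [show i + c - b + (-c - -b) = i by ring] at h3
      exact hi h3
  · obtain ⟨hw1, hwi, a, hwa⟩ := hform hw
    have hne : w * g ≠ 1 := by
      intro h
      rw [h] at hw'
      rcases hSform hw' with ⟨i, hi, h⟩ | h
      · exact hi ((zpow_eq_one_iff_dvd hp hx (ne_one_of_conj_notMem hy hxy)).1 h.symm)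
      · exact (hform h).1 rfl
    rcases hSform hw' with ⟨i, hi, h⟩ | h
    · have e : y * x ^ (c - a) * y = x ^ (-a + i + c) := by
        calc y * x ^ (c - a) * y = x ^ (-a) * ((x ^ a * y * x ^ (-a)) * (x ^ c * y * x ^ (-c))) *
              x ^ c := by rw [zpow_sub]; group
          _ = _ := by rw [← hwa, ← hgc, h, zpow_add, zpow_add]
      have h2 := dvd_of_conj_zpow_mem hp hx hy hxy (n := c - a) ⟨_, e.symm⟩
      refine hne ?_
      have h3 := (zpow_eq_one_iff_dvd hp hx (ne_one_of_conj_notMem hy hxy)).2 h2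
      have h4 : x ^ c = x ^ a := by rwa [zpow_sub, mul_inv_eq_one] at h3
      have h5 : w = g := by rw [hwa, hgc, zpow_neg, zpow_neg, h4]
      rw [← h5]
      nth_rw 1 [← hwi]
      simp
    · rcases hg with rfl | rfl <;> rcases hw with rfl | rfl
      · exact hne hyy
      · rcases h with h | h
        · exact hw1 (mul_eq_right.1 h)
        · exact hg1 (mul_eq_left.1 h)
      · rcases h with h | h
        · exact hg1 (mul_eq_left.1 h)
        · exact hw1 (mul_eq_right.1 h)
      · exact hne (inv_eq_iff_mul_eq_one.1 hwi)

/-- An automorphism of `Cay(G, S)` preserves the edges labelled by `x`. -/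
theorem map_generator_mul {G : Type*} [Group G] [Finite G] {k p : ℕ} (hp : p.Prime)
    (hpk : 3 * ((k - 1) / 2) + 1 ≤ p) (hk : 5 ≤ k) {x y : G} (hx : x ^ p = 1) (hy : y ^ 2 = 1)
    (hxy : y * x * y ∉ Subgroup.zpowers x)
    (φ : cayleyGraph (connectionSet k x y) ≃g cayleyGraph (connectionSet k x y)) (u : G) :
    φ (x * u) = x * φ u ∨ φ (x * u) = x⁻¹ * φ u := by
  have h1 := one_notMem_connectionSet (k := k) (by omega) hp (by omega) hx hxy hy
  have hinv := inv_mem_connectionSet (k := k) (x := x) hy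
  have hx1 := ne_one_of_conj_notMem hy hxy
  have hadj : (cayleyGraph (connectionSet k x y)).Adj u (x * u) := by
    rw [cayleyGraph_adj_iff h1 hinv, mul_inv_cancel_right]
    exact mem_connectionSet_iff.2 (Or.inl ⟨1, by norm_num, by rw [abs_one]; omega, by simp⟩)
  have hadj' := φ.map_rel_iff.2 hadj
  rw [cayleyGraph_adj_iff h1 hinv] at hadj'
  have hcn := ncard_commonNeighbors_map φ u (x * u)
  rw [ncard_commonNeighbors_cayleyGraph h1 hinv, ncard_commonNeighbors_cayleyGraph h1 hinv,
    mul_inv_cancel_right] at hcn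
  have hlow := le_ncard_commonNeighborsOne hp hpk hk hx hy hxy
  rw [← hcn] at hlow
  have hempty : ¬ (φ (x * u) * (φ u)⁻¹ = y ∨ φ (x * u) * (φ u)⁻¹ = x⁻¹ * y * x) := by
    intro h
    rw [commonNeighborsOne_eq_empty hp hpk hx hy hxy h, Set.ncard_empty] at hlow
    omega
  rcases mem_connectionSet_iff.1 hadj' with ⟨j, hj0, hj, he⟩ | h | ⟨-, h⟩
  · by_cases hj2 : 2 ≤ |j|
    · have := ncard_commonNeighborsOne_zpow_le (y := y) hp hpk hx hy hxy hj2 hj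
      rw [← he] at this
      omega
    · have : j = 1 ∨ j = -1 := by
        have := abs_cases j
        omega
      rcases this with rfl | rfl
      · exact Or.inl (mul_inv_eq_iff_eq_mul.1 (by rw [he, zpow_one]))
      · exact Or.inr (mul_inv_eq_iff_eq_mul.1 (by rw [he, zpow_neg_one]))
  · exact absurd (Or.inl h) hempty
  · exact absurd (Or.inr h) hempty

/-! ### Action of automorphisms on the cosets of `⟨x⟩` and on the involution edges. -/

/-- An injective map preserving `x`-edges is a dihedral symmetry on each coset `⟨x⟩u`. -/
theorem map_zpow_mul {G : Type*} [Group G] {x : G} (hx2 : x * x ≠ 1) {f : G → G}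
    (hfi : Function.Injective f) (hf : ∀ u, f (x * u) = x * f u ∨ f (x * u) = x⁻¹ * f u)
    {c u : G} (hc : c = x ∨ c = x⁻¹) (h : f (x * u) = c * f u) (n : ℤ) :
    f (x ^ n * u) = c ^ n * f u := by
  have hf' : ∀ c u, (c = x ∨ c = x⁻¹) → f (x * u) = c * f u ∨ f (x * u) = c⁻¹ * f u := by
    rintro c u (rfl | rfl)
    · exact hf u
    · rw [inv_inv]
      exact (hf u).symm
  -- A change of direction would send `x * (x * u)` and `u` to the same vertex.
  have step : ∀ c u, (c = x ∨ c = x⁻¹) → f (x * u) = c * f u → f (x * (x * u)) = c * f (x * u) := by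
    intro c u hc h
    refine (hf' c (x * u) hc).resolve_right fun h' => hx2 ?_
    rw [h, inv_mul_cancel_left, ← mul_assoc] at h'
    exact mul_eq_right.1 (hfi h')
  have back : ∀ u, f (x * u) = c * f u → f u = c * f (x⁻¹ * u) := by
    intro u h
    have h' := hf' c (x⁻¹ * u) hc
    have e : x * (x⁻¹ * u) = u := mul_inv_cancel_left _ _
    rw [e] at h'
    refine h'.resolve_right fun h' => hx2 ?_
    have h2 := step c⁻¹ (x⁻¹ * u) (by rcases hc with rfl | rfl <;> simp) (by rw [e]; exact h')
    rw [e, h] at h2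
    have h3 := mul_right_cancel h2
    rcases hc with rfl | rfl
    · nth_rw 1 [h3]
      simp
    · rw [inv_inv] at h3
      nth_rw 1 [← h3]
      simp
  have all : ∀ n : ℤ, f (x ^ n * u) = c ^ n * f u ∧ f (x * (x ^ n * u)) = c * f (x ^ n * u) := by
    intro n
    induction n with
    | zero => simpa using h
    | succ n ih =>
      have e : x ^ ((n : ℤ) + 1) * u = x * (x ^ (n : ℤ) * u) := by
        rw [← mul_assoc, add_comm, zpow_one_add]
      rw [e]
      refine ⟨?_, step _ _ hc ih.2⟩
      rw [ih.2, ih.1, ← mul_assoc, add_comm, zpow_one_add]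
    | pred n ih =>
      have e : x ^ (-(n : ℤ) - 1) * u = x⁻¹ * (x ^ (-n : ℤ) * u) := by
        rw [← mul_assoc, sub_eq_neg_add, zpow_add, zpow_neg_one]
      have h2 := back _ ih.2
      rw [e]
      refine ⟨?_, ?_⟩
      · rw [sub_eq_neg_add, zpow_add, zpow_neg_one, mul_assoc, ← ih.1, h2, inv_mul_cancel_left]
      · rw [mul_inv_cancel_left]
        exact h2
  exact (all n).1

theorem map_involution_mul {G : Type*} [Group G] [Finite G] {k p : ℕ} (hp : p.Prime)
    (hpk : 3 * ((k - 1) / 2) + 1 ≤ p) (hk : 5 ≤ k) {x y : G} (hx : x ^ p = 1) (hy : y ^ 2 = 1)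
    (hxy : y * x * y ∉ Subgroup.zpowers x)
    (φ : cayleyGraph (connectionSet k x y) ≃g cayleyGraph (connectionSet k x y)) {s : G}
    (hs : s ∈ connectionSet k x y) (hsx : s ∉ Subgroup.zpowers x) (u : G) :
    φ (s * u) = y * φ u ∨ (Even k ∧ φ (s * u) = x⁻¹ * y * x * φ u) := by
  have h1 := one_notMem_connectionSet (k := k) (by omega) hp (by omega) hx hxy hy
  have hinv := inv_mem_connectionSet (k := k) (x := x) hy
  have hadj : (cayleyGraph (connectionSet k x y)).Adj u (s * u) := by
    rwa [cayleyGraph_adj_iff h1 hinv, mul_inv_cancel_right]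
  have hadj' := φ.map_rel_iff.2 hadj
  rw [cayleyGraph_adj_iff h1 hinv] at hadj'
  rcases mem_connectionSet_iff.1 hadj' with ⟨j, -, -, he⟩ | h | ⟨hk, h⟩
  · exfalso
    have hx2 : x * x ≠ 1 := fun h => by
      have h' : x ^ (2 : ℤ) = 1 := by rw [zpow_two, h]
      rw [zpow_eq_one_iff_dvd hp hx (ne_one_of_conj_notMem hy hxy)] at h'
      have := Int.le_of_dvd (by norm_num) h'
      omega
    -- If the image edge stayed inside a coset of `⟨x⟩`, then `φ⁻¹`, which maps such cosets to such
    -- cosets, would put `s` in `⟨x⟩`.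
    have hψ := map_generator_mul hp hpk hk hx hy hxy φ⁻¹
    obtain ⟨c, hc, h⟩ : ∃ c, (c = x ∨ c = x⁻¹) ∧ φ⁻¹ (x * φ u) = c * φ⁻¹ (φ u) := by
      rcases hψ (φ u) with h | h
      · exact ⟨x, Or.inl rfl, h⟩
      · exact ⟨x⁻¹, Or.inr rfl, h⟩
    have h2 := map_zpow_mul hx2 φ⁻¹.injective hψ hc h j
    rw [← he, inv_mul_cancel_right] at h2
    have hi : ∀ g, φ⁻¹ (φ g) = g := φ.symm_apply_apply
    rw [hi, hi] at h2
    refine hsx (mul_right_cancel h2 ▸ Subgroup.zpow_mem _ ?_ j)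
    rcases hc with rfl | rfl
    · exact Subgroup.mem_zpowers _
    · exact inv_mem (Subgroup.mem_zpowers _)
  · exact Or.inl (mul_inv_eq_iff_eq_mul.1 h)
  · exact Or.inr ⟨hk, mul_inv_eq_iff_eq_mul.1 h⟩

/-- The stabiliser of a vertex in the automorphism group of a graph. -/
def vertexStabilizer {V : Type*} (Γ : SimpleGraph V) (u : V) : Subgroup (Γ ≃g Γ) where
  carrier := {φ | φ u = u}
  one_mem' := rfl
  mul_mem' := by
    intro φ ψ (hφ : φ u = u) (hψ : ψ u = u)
    change φ (ψ u) = u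
    rw [hψ, hφ]
  inv_mem' := by
    intro φ (hφ : φ u = u)
    change φ⁻¹ u = u
    nth_rw 1 [← hφ]
    exact φ.symm_apply_apply u

theorem mem_vertexStabilizer {V : Type*} {Γ : SimpleGraph V} {u : V} {φ : Γ ≃g Γ} :
    φ ∈ vertexStabilizer Γ u ↔ φ u = u := Iff.rfl

/-- If `x` and `y` are generators, a property stable under left multiplication by `x^{±1}` and `y`
holds everywhere once it holds at `1`. -/
theorem forall_of_left_mul {G : Type*} [Group G] {x y : G} (hgen : Subgroup.closure {x, y} = ⊤)
    (hy : y ^ 2 = 1) {q : G → Prop} (h1 : q 1) (hx : ∀ u, q u → q (x * u))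
    (hx' : ∀ u, q u → q (x⁻¹ * u)) (hyq : ∀ u, q u → q (y * u)) (u : G) : q u := by
  have hyi : y⁻¹ = y := inv_eq_of_mul_eq_one_left (mul_self_eq_one_of_sq hy)
  have hu : u ∈ Subgroup.closure {x, y} := hgen ▸ Subgroup.mem_top u
  induction hu using Subgroup.closure_induction_left with
  | one => exact h1
  | mul_left t ht v _ ih =>
    rcases ht with rfl | rfl
    · exact hx v ih
    · exact hyq v ih
  | inv_mul_cancel t ht v _ ih =>
    rcases ht with rfl | rfl
    · exact hx' v ih
    · rw [hyi]
      exact hyq v ih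

/-! ### Odd `k`: the vertex stabiliser has order at most 4. -/

section LocallyDihedral

variable {G : Type*} [Group G] {S : Set G} {x y : G}

/-- On the cycle through a fixed vertex `φ` is the identity or a reflection, so `φ ^ 2` fixes it
pointwise, and by odd order so does `φ`. Fixed points then spread along `y`-edges to the whole
graph. -/
theorem eq_one_of_odd_pow (hgen : Subgroup.closure {x, y} = ⊤) (hy : y ^ 2 = 1)
    (hx2 : x * x ≠ 1)
    (hφx : ∀ (φ : cayleyGraph S ≃g cayleyGraph S) u, φ (x * u) = x * φ u ∨ φ (x * u) = x⁻¹ * φ u)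
    (hφy : ∀ (φ : cayleyGraph S ≃g cayleyGraph S) u, φ (y * u) = y * φ u)
    {φ : cayleyGraph S ≃g cayleyGraph S} (hφ1 : φ 1 = 1) {m : ℕ} (hm : Odd m)
    (hφm : φ ^ m = 1) : φ = 1 := by
  have hpow : ∀ {ψ : cayleyGraph S ≃g cayleyGraph S} {u}, ψ u = u → ∀ n : ℕ, (ψ ^ n) u = u :=
    fun h n => (vertexStabilizer _ _).pow_mem (mem_vertexStabilizer.2 h) n
  have hsq : ∀ {u}, (φ ^ 2) u = u → φ u = u := by
    intro u h
    obtain ⟨n, rfl⟩ := hm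
    have h2 := hpow h n
    rw [← pow_mul] at h2
    nth_rw 1 [← h2]
    have h3 : φ * φ ^ (2 * n) = 1 := by rw [← pow_succ', hφm]
    exact congrArg (fun ψ : cayleyGraph S ≃g cayleyGraph S => ψ u) h3
  have hrot : ∀ u, φ u = u → ∀ n : ℤ, φ (x ^ n * u) = x ^ n * u := by
    intro u hu n
    have key : ∀ c, (c = x ∨ c = x⁻¹) → φ (x * u) = c * φ u → φ (x ^ n * u) = x ^ n * u := by
      intro c hc h
      refine hsq ?_
      have hz := map_zpow_mul hx2 φ.injective (hφx φ) hc h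
      have h2 : φ (φ (x ^ n * u)) = x ^ n * u := by
        rw [hz n, hu]
        rcases hc with rfl | rfl
        · rw [hz, hu]
        · have := hz (-n)
          rw [hu, inv_zpow', neg_neg] at this
          rw [inv_zpow', this]
      rwa [sq]
    rcases hφx φ u with h | h
    · exact key x (Or.inl rfl) h
    · exact key _ (Or.inr rfl) h
  ext u
  refine forall_of_left_mul hgen hy (q := fun u => φ u = u) hφ1 (fun u hu => ?_) (fun u hu => ?_)
    (fun u hu => ?_) u
  · simpa using hrot u hu 1
  · simpa using hrot u hu (-1)
  · rw [hφy, hu]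

theorem card_vertexStabilizer_le_four [Finite G] {p : ℕ} (hp : p.Prime) (h5 : 5 ≤ p)
    (hgen : Subgroup.closure {x, y} = ⊤) (hx : x ^ p = 1) (hy : y ^ 2 = 1) (hx2 : x * x ≠ 1)
    (hφx : ∀ (φ : cayleyGraph S ≃g cayleyGraph S) u, φ (x * u) = x * φ u ∨ φ (x * u) = x⁻¹ * φ u)
    (hφy : ∀ (φ : cayleyGraph S ≃g cayleyGraph S) u, φ (y * u) = y * φ u) :
    Nat.card (vertexStabilizer (cayleyGraph S) 1) ≤ 4 := by
  have hfin : Finite (cayleyGraph S ≃g cayleyGraph S) :=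
    Finite.of_injective _ DFunLike.coe_injective
  set P := vertexStabilizer (cayleyGraph S) 1
  set K := P ⊓ vertexStabilizer (cayleyGraph S) x
  have hx' : ∀ φ ∈ P, φ x = x ∨ φ x = x⁻¹ := fun φ (hφ : φ 1 = 1) => by
    simpa [hφ] using hφx φ 1
  have hxi : ∀ φ ∈ P, ∀ c, (c = x ∨ c = x⁻¹) → φ x = c → φ x⁻¹ = c⁻¹ := by
    intro φ (hφ : φ 1 = 1) c hc h
    have := map_zpow_mul hx2 φ.injective (hφx φ) (u := 1) hc (by rw [mul_one, hφ, mul_one, h]) (-1)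
    simpa [hφ] using this
  have hnotK : ∀ φ ∈ P, φ ∉ K → φ x = x⁻¹ ∧ φ x⁻¹ = x := by
    intro φ hφ hφK
    have h : φ x = x⁻¹ := (hx' φ hφ).resolve_left fun h => hφK ⟨hφ, h⟩
    exact ⟨h, by simpa using hxi φ hφ _ (Or.inr rfl) h⟩
  have hsymm : ∀ {φ : cayleyGraph S ≃g cayleyGraph S} {u v}, φ u = v → φ⁻¹ v = u := by
    rintro φ u v rfl
    exact φ.symm_apply_apply u
  have hy' : y⁻¹ = y := inv_eq_of_mul_eq_one_left (mul_self_eq_one_of_sq hy)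
  -- `r` is `u ↦ u * x` and `t` is `u ↦ u * y`. Elements of `P` outside `K` reverse the cycle `⟨x⟩`,
  -- hence invert `r` modulo `K`.
  refine card_le_four (K := K) (r := rightMulIso S x⁻¹) (t := rightMulIso S y) hp h5
    inf_le_left ?_ ?_ ?_ ?_ ?_ ?_ ?_ ?_
  · rw [← map_pow, inv_pow, hx, inv_one, map_one]
  · rw [← map_mul, mul_self_eq_one_of_sq hy, map_one]
  · intro φ (hφ : φ 1 = 1)
    change (rightMulIso S y * φ * (rightMulIso S y)⁻¹) 1 = 1
    have := hφy φ 1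
    rw [hφ, mul_one] at this
    simp [this]
  · rintro φ ⟨hφ, hφ' : φ x = x⟩
    have h := hxi φ hφ x (Or.inl rfl) hφ'
    have hφ : φ 1 = 1 := hφ
    constructor
    · change (rightMulIso S x⁻¹ * φ * (rightMulIso S x⁻¹)⁻¹) 1 = 1
      simp [h]
    · change (rightMulIso S x⁻¹ * φ * (rightMulIso S x⁻¹)⁻¹) x = x
      simp [hφ]
  -- The 2-power part of the order of `φ` gives a power of odd order, which is trivial.
  · intro φ (hφ : φ 1 = 1)
    obtain ⟨n, m, hm, he⟩ := Nat.exists_eq_two_pow_mul_odd (orderOf_pos φ).ne'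
    refine ⟨n, eq_one_of_odd_pow hgen hy hx2 hφx hφy ?_ hm ?_⟩
    · exact P.pow_mem hφ _
    · rw [← pow_mul, ← he, pow_orderOf_eq_one]
  · intro φ hφ hφK
    obtain ⟨h1, h2⟩ := hnotK φ hφ hφK
    have hφ : φ 1 = 1 := hφ
    have i1 := hsymm hφ
    have i2 := hsymm h2
    constructor
    · change (rightMulIso S x⁻¹ * (φ * rightMulIso S x⁻¹ * φ⁻¹)) 1 = 1
      simp [i1, h1]
    · change (rightMulIso S x⁻¹ * (φ * rightMulIso S x⁻¹ * φ⁻¹)) x = x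
      simp [i2, hφ]
  · intro φ hφ ψ hψ hφK hψK
    refine ⟨P.mul_mem hφ (P.inv_mem hψ), ?_⟩
    change φ (ψ⁻¹ x) = x
    rw [hsymm (hnotK ψ hψ hψK).2, (hnotK φ hφ hφK).2]
  · intro N hNP hNx hNy
    -- A subgroup of `P` normalised by all translations fixes every vertex, since translations carry
    -- each vertex to `1`.
    have hnorm : ∀ g, rightMulIso S g ∈ Subgroup.normalizer (N : Set _) := by
      have htop : (⊤ : Subgroup G) ≤ (Subgroup.normalizer (N : Set _)).comap (rightMulIso S) := by
        rw [← hgen, Subgroup.closure_le]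
        rintro t (rfl | rfl)
        · change rightMulIso S t ∈ Subgroup.normalizer (N : Set _)
          rw [← inv_inv (rightMulIso S t), ← map_inv]
          exact inv_mem (Subgroup.mem_normalizer_fintype hNx)
        · exact Subgroup.mem_normalizer_fintype hNy
      exact fun g => htop (Subgroup.mem_top g)
    rw [Subgroup.eq_bot_iff_forall]
    intro φ hφ
    ext u
    have h : (rightMulIso S u * φ * (rightMulIso S u)⁻¹) 1 = 1 :=
      hNP ((Subgroup.mem_normalizer_iff.1 (hnorm u) φ).1 hφ)
    have h : φ (1 * u) * u⁻¹ = 1 := by simpa using h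
    rw [one_mul, mul_inv_eq_one] at h
    exact h

end LocallyDihedral

/-! ### Even `k`: every automorphism fixing `1` is multiplicative. -/

section

variable {G : Type*} [Group G] [Finite G] {k p : ℕ} {x y : G}

/-- For even `k`, the two edges between adjacent cosets of `⟨x⟩` lie on a common `4`-cycle, so that
the sense in which an automorphism traverses `⟨x⟩u` determines its action at `yu`. -/
theorem map_involution_mul_of_even (hp : p.Prime)
    (hpk : 3 * ((k - 1) / 2) + 1 ≤ p) (hk : 5 ≤ k) (hke : Even k) (hx : x ^ p = 1)
    (hy : y ^ 2 = 1) (hxy : y * x * y ∉ Subgroup.zpowers x) (hx2 : x * x ≠ 1)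
    (φ : cayleyGraph (connectionSet k x y) ≃g cayleyGraph (connectionSet k x y)) (u : G) :
    (φ (x * u) = x * φ u → φ (y * u) = y * φ u ∧ φ (x * (y * u)) = x * φ (y * u)) ∧
    (φ (x * u) = x⁻¹ * φ u →
      φ (y * u) = x⁻¹ * y * x * φ u ∧ φ (x * (y * u)) = x⁻¹ * φ (y * u)) := by
  have hf := map_generator_mul hp hpk hk hx hy hxy φ
  have hsign : ∀ u, ∃ c : ℤ, (c = 1 ∨ c = -1) ∧ φ (x * u) = x ^ c * φ u ∧
      φ (x⁻¹ * u) = x ^ (-c) * φ u := by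
    intro u
    rcases hf u with h | h
    · refine ⟨1, Or.inl rfl, by simpa using h, ?_⟩
      simpa using map_zpow_mul hx2 φ.injective hf (Or.inl rfl) h (-1)
    · refine ⟨-1, Or.inr rfl, by simpa using h, ?_⟩
      simpa using map_zpow_mul hx2 φ.injective hf (Or.inr rfl) h (-1)
  have hyx : y ∉ Subgroup.zpowers x := by
    simpa using mul_mul_notMem_zpowers hxy 0 0
  have hzx : x⁻¹ * y * x ∉ Subgroup.zpowers x := by
    simpa using mul_mul_notMem_zpowers hxy (-1) 1
  have hinv : ∀ s ∈ connectionSet k x y, s ∉ Subgroup.zpowers x → ∀ u, ∃ a : ℤ,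
      (a = 0 ∨ a = -1) ∧ φ (s * u) = x ^ a * y * x ^ (-a) * φ u := by
    intro s hs hsx u
    rcases map_involution_mul hp hpk hk hx hy hxy φ hs hsx u with h | ⟨-, h⟩
    · exact ⟨0, Or.inl rfl, by simpa using h⟩
    · exact ⟨-1, Or.inr rfl, by simpa using h⟩
  obtain ⟨c, hc, hcx, hci⟩ := hsign u
  obtain ⟨e, he, hex, hei⟩ := hsign (y * u)
  obtain ⟨a, ha, hay⟩ := hinv y (mem_connectionSet_iff.2 (Or.inr (Or.inl rfl))) hyx u
  obtain ⟨b, hb, hbz⟩ := hinv (x⁻¹ * y * x)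
    (mem_connectionSet_iff.2 (Or.inr (Or.inr ⟨hke, rfl⟩))) hzx (x⁻¹ * u)
  -- This closes the 4-cycle `u`, `yu`, `x⁻¹yu`, `x⁻¹u`. Comparing its two images gives `a - e = b`
  -- and `a = b + c`, as exact equalities because the exponents are small; so `e = c`, and `c`
  -- determines `a`.
  have hsq : x⁻¹ * y * x * (x⁻¹ * u) = x⁻¹ * (y * u) := by group
  rw [hsq, hei, hay, hci] at hbz
  have hrel : x ^ (a - e) * y * x ^ (-a) = x ^ b * y * x ^ (-b - c) := by
    have h : x ^ (-e) * (x ^ a * y * x ^ (-a)) = x ^ b * y * x ^ (-b) * x ^ (-c) :=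
      mul_right_cancel (b := φ u) (by simpa only [mul_assoc] using hbz)
    calc x ^ (a - e) * y * x ^ (-a) = x ^ (-e) * (x ^ a * y * x ^ (-a)) := by
          rw [sub_eq_neg_add, zpow_add]
          simp only [mul_assoc]
      _ = x ^ b * y * x ^ (-b) * x ^ (-c) := h
      _ = _ := by rw [sub_eq_add_neg, zpow_add, ← mul_assoc]
  obtain ⟨d1, d2⟩ := dvd_of_mul_mul_eq hp hx hy hxy hrel
  have z1 : a - e - b = 0 := Int.eq_zero_of_abs_lt_dvd d1 (by rw [abs_lt]; omega)
  have z2 : -a - (-b - c) = 0 := Int.eq_zero_of_abs_lt_dvd d2 (by rw [abs_lt]; omega)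
  have hne : x ≠ x⁻¹ := fun h => hx2 (by nth_rw 1 [h]; simp)
  rcases hc with rfl | rfl
  · obtain rfl : a = 0 := by omega
    obtain rfl : e = 1 := by omega
    refine ⟨fun _ => ⟨by simpa using hay, by simpa using hex⟩, fun h => absurd ?_ hne⟩
    rw [h, zpow_one] at hcx
    exact (mul_right_cancel hcx).symm
  · obtain rfl : a = -1 := by omega
    obtain rfl : e = -1 := by omega
    refine ⟨fun h => absurd ?_ hne, fun _ => ⟨by simpa using hay, by simpa using hex⟩⟩
    rw [h, zpow_neg_one] at hcx
    exact mul_right_cancel hcx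

theorem map_mul_of_even (hp : p.Prime) (hpk : 3 * ((k - 1) / 2) + 1 ≤ p) (hk : 5 ≤ k)
    (hke : Even k) (hgen : Subgroup.closure {x, y} = ⊤) (hx : x ^ p = 1) (hy : y ^ 2 = 1)
    (hxy : y * x * y ∉ Subgroup.zpowers x) (hx2 : x * x ≠ 1)
    {φ : cayleyGraph (connectionSet k x y) ≃g cayleyGraph (connectionSet k x y)}
    (hφ : φ 1 = 1) (u v : G) : φ (u * v) = φ u * φ v := by
  have hf := map_generator_mul hp hpk hk hx hy hxy φ
  have hy4 := map_involution_mul_of_even hp hpk hk hke hx hy hxy hx2 φ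
  have hconst : ∀ c, (c = x ∨ c = x⁻¹) → φ (x * 1) = c * φ 1 → ∀ u, φ (x * u) = c * φ u := by
    intro c hc h1 u
    refine forall_of_left_mul hgen hy (q := fun u => φ (x * u) = c * φ u) h1 (fun u hu => ?_)
      (fun u hu => ?_) (fun u hu => ?_) u
    · have := map_zpow_mul hx2 φ.injective hf hc hu 2
      rw [zpow_two, zpow_two, mul_assoc, mul_assoc, ← hu] at this
      exact this
    · have := map_zpow_mul hx2 φ.injective hf hc hu (-1)
      rw [zpow_neg_one, zpow_neg_one] at this
      rw [this, mul_inv_cancel_left, mul_inv_cancel_left]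
    · rcases hc with rfl | rfl
      · exact ((hy4 u).1 hu).2
      · exact ((hy4 u).2 hu).2
  refine map_mul_of_generators hgen hφ ?_ u v
  rintro t (rfl | rfl)
  · rcases hf 1 with h | h
    · exact ⟨_, hconst _ (Or.inl rfl) h⟩
    · exact ⟨_, hconst _ (Or.inr rfl) h⟩
  · rcases hf 1 with h | h
    · exact ⟨_, fun u => ((hy4 u).1 (hconst _ (Or.inl rfl) h u)).1⟩
    · exact ⟨_, fun u => ((hy4 u).2 (hconst _ (Or.inr rfl) h u)).1⟩

end

theorem theorem1p2 (k : ℕ) (hk : 5 ≤ k) (p : ℕ) (hp : p.Prime)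
    (hpk : 3 * ⌈(k : ℚ) / 2⌉ - 2 ≤ (p : ℤ))
    {G : Type*} [Group G] [Finite G] (x y : G)
    (hgen : Subgroup.closure {x, y} = (⊤ : Subgroup G))
    (hx : x ^ p = 1) (hy : y ^ 2 = 1)
    (hxy : y * x * y ∉ Subgroup.zpowers x)
    (hindex : ∀ H : Subgroup G, H ≠ ⊤ → 4 ≤ H.index) :
    IsGRR (cayleyGraph (connectionSet k x y)) G ↔
      autStabilizer G (connectionSet k x y) = ⊥ := by
  refine ⟨autStabilizer_eq_bot_of_isGRR, fun haut => isGRR_of_forall_eq_one fun φ hφ => ?_⟩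
  have hpk' : 3 * ((k - 1) / 2) + 1 ≤ p := by
    -- From `d + 1 ≤ ⌈k/2⌉` follows `3d + 1 ≤ 3⌈k/2⌉ - 2 ≤ p`.
    have h : (((k - 1) / 2 : ℕ) : ℤ) < ⌈(k : ℚ) / 2⌉ := by
      rw [Int.lt_ceil, lt_div_iff₀ (by norm_num)]
      have : (k - 1) / 2 * 2 < k := by omega
      exact_mod_cast this
    omega
  have h1 := one_notMem_connectionSet (k := k) (by omega) hp (by omega) hx hxy hy
  have hinv := inv_mem_connectionSet (k := k) (x := x) hy
  have hx2 : x * x ≠ 1 := fun h => by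
    have h' : x ^ (2 : ℤ) = 1 := by rw [zpow_two, h]
    rw [zpow_eq_one_iff_dvd hp hx (ne_one_of_conj_notMem hy hxy)] at h'
    have := Int.le_of_dvd (by norm_num) h'
    omega
  refine eq_one_of_map_mul h1 hinv haut hφ ?_
  rcases Nat.even_or_odd k with hke | hko
  · exact map_mul_of_even hp hpk' hk hke hgen hx hy hxy hx2 hφ
  · have hyx : y ∉ Subgroup.zpowers x := by
      simpa using mul_mul_notMem_zpowers hxy 0 0
    have hφy : ∀ (φ : cayleyGraph (connectionSet k x y) ≃g cayleyGraph (connectionSet k x y)) u,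
        φ (y * u) = y * φ u := fun φ u =>
      (map_involution_mul hp hpk' hk hx hy hxy φ (mem_connectionSet_iff.2 (Or.inr (Or.inl rfl)))
        hyx u).resolve_right fun h => Nat.not_even_iff_odd.2 hko h.1
    exact map_mul_of_card_le_four hindex (fun _ h => h)
      (card_vertexStabilizer_le_four hp (by omega) hgen hx hy hx2
        (map_generator_mul hp hpk' hk hx hy hxy) hφy) hφ
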